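/- Write $\langle t\rangle=(1+|t|^2)^{1/2}$ for $t\in\mathbb{R}$ and $\widehat f(\xi)=(2\pi)^{-d}\int_{\mathbb{R}^d}f(x)e^{-i\xi\cdot x}\,dx$. For a function $\Phi\in C^\infty(\mathbb{R}^d\setminus\{0\},\mathbb{R})$ that is homogeneous of degree $0$ (that is, $\Phi(r\xi)=\Phi(\xi)$ for all $r>0$, $\xi\neq0$) and $t\in\mathbb{R}$, let $T_\Phi^t$ be the Fourier multiplier operator defined on Schwartz functions $f\in\mathcal{S}(\mathbb{R}^d)$ by $$T_\Phi^t f(x)=\int_{\mathbb{R}^d}e^{it\Phi(\xi)+i\xi\cdot x}\,\widehat f(\xi)\,d\xi ,$$ and let $\|T_\Phi^t\|_{L^p\to L^p}=\sup_{0\neq f\in\mathcal{S}(\mathbb{R}^d)}\|T_\Phi^tf\|_{L^p}/\|f\|_{L^p}$. Let $1<p<\infty$. (a) Let $d=2$. For every nonconstant $\Phi\in C^\infty(\mathbb{R}^2\setminus\{0\},\mathbb{R})$ that is homogeneous of degree $0$ there is a constant $c=c_{p,\Phi}>0$ such that for all $t\in\mathbb{R}$ $$\|T_\Phi^t\|_{L^p\to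 L^p}\ \ge\ c\,\langle t\rangle^{2\left|\frac12-\frac1p\right|}.$$ (b) Let $d\ge3$. There is a set $\mathcal{G}\subseteq C^\infty(S^{d-1},\mathbb{R})$, independent of $p$, that is open and dense in the Whitney (strong $C^\infty$) topology, such that for every $\phi\in\mathcal{G}$ the $0$-homogeneous extension $\Phi(\xi)=\phi(\xi/|\xi|)$ belongs to $C^\infty(\mathbb{R}^d\setminus\{0\},\mathbb{R})$ and there is a constant $c=c_{d,p,\phi}>0$ such that for all $t\in\mathbb{R}$ $$\|T_\Phi^t\|_{L^p\to L^p}\ \ge\ c\,\langle t\rangle^{d\left|\frac12-\frac1p\right|}.$$ One may take for $\mathcal{G}$ the set of all Morse functions on $S^{d-1}$, that is, of the smooth functions all of whose critical points are nondegenerate (in a local chart the Hessian matrix at the critical point is invertible). -/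

import Mathlib

open scoped Manifold ContDiff ENNReal SchwartzMap Topology

noncomputable section

namespace GenericMultiplier

/-- Euclidean space `ℝ^d`. -/
abbrev Euc (d : ℕ) : Type := EuclideanSpace ℝ (Fin d)

/-- The unit sphere `S^n ⊆ ℝ^(n+1)`. -/
abbrev Sph (n : ℕ) : Type := Metric.sphere (0 : Euc (n + 1)) 1

/-- The Japanese bracket `⟨t⟩ = (1 + |t|^2)^(1/2)`. -/
def japanese (t : ℝ) : ℝ := Real.sqrt (1 + |t| ^ 2)

/-! ### The multiplier operators -/

/-- `Φ` is a smooth, `0`-homogeneous function on `ℝ^d ∖ {0}`. The value at `0` is irrelevant. -/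
structure IsSmoothZeroHomogeneous {d : ℕ} (Φ : Euc d → ℝ) : Prop where
  smooth : ContDiffOn ℝ ∞ Φ {0}ᶜ
  homogeneous : ∀ r : ℝ, 0 < r → ∀ ξ : Euc d, ξ ≠ 0 → Φ (r • ξ) = Φ ξ

/-- The Fourier transform normalized as `(2π)^(-d) ∫ f(x) e^{-i ξ·x} dx`. -/
def fourierHat {d : ℕ} (f : Euc d → ℂ) (ξ : Euc d) : ℂ :=
  (1 / (2 * (Real.pi : ℂ)) ^ d) *
    ∫ x : Euc d, f x * Complex.exp (-Complex.I * ((inner ℝ ξ x : ℝ) : ℂ))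

/-- `T_Φ^t f (x) = ∫ e^{i t Φ(ξ) + i ξ·x} f^(ξ) dξ` on Schwartz functions. -/
def multiplierOp {d : ℕ} (Φ : Euc d → ℝ) (t : ℝ) (f : 𝓢(Euc d, ℂ)) (x : Euc d) : ℂ :=
  ∫ ξ : Euc d,
    Complex.exp (Complex.I * ((t * Φ ξ : ℝ) : ℂ) + Complex.I * ((inner ℝ ξ x : ℝ) : ℂ)) *
      fourierHat f ξ

/-- The `L^p → L^p` norm of `T_Φ^t`: the supremum of `‖T_Φ^t f‖_p / ‖f‖_p` over the nonzero
Schwartz functions, as an extended nonnegative real. -/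
def multiplierNorm {d : ℕ} (Φ : Euc d → ℝ) (t : ℝ) (p : ℝ) : ℝ≥0∞ :=
  ⨆ (f : 𝓢(Euc d, ℂ)) (_ : f ≠ 0),
    MeasureTheory.eLpNorm (multiplierOp Φ t f) (ENNReal.ofReal p) MeasureTheory.volume /
      MeasureTheory.eLpNorm (fun x => f x) (ENNReal.ofReal p) MeasureTheory.volume

/-! ### Whitney topology and Morse functions -/

section Manifold

variable {n : ℕ} {M : Type} [TopologicalSpace M] [ChartedSpace (Euc n) M]

/-- The strong basic neighbourhood of order `r` of `f` in `C^∞(M, ℝ)`: given charts `ψ i`,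
sets `K i` in their domains and `ε i > 0`, the set of all `g` such that in the chart `ψ i`
all derivatives of orders `0, …, r` of `f` and `g` differ by less than `ε i` on `K i`. On the
target `ℝ` the identity chart is used. -/
def strongNhd (f : C^∞⟮𝓡 n, M; ℝ⟯) (r : ℕ) {ι : Type}
    (ψ : ι → OpenPartialHomeomorph M (Euc n)) (K : ι → Set M) (ε : ι → ℝ) :
    Set C^∞⟮𝓡 n, M; ℝ⟯ :=
  {g | ∀ i, ∀ x ∈ K i, ∀ k ≤ r,
    ‖iteratedFDeriv ℝ k (g ∘ (ψ i).symm) (ψ i x) -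
      iteratedFDeriv ℝ k (f ∘ (ψ i).symm) (ψ i x)‖ < ε i}

/-- The Whitney (strong) `C^∞` topology on `C^∞(M, ℝ)`: generated by the sets `strongNhd`, over
all finite orders, all families of smooth charts with locally finite domains, all compact subsets
of these domains, and all families of positive tolerances. -/
abbrev whitneyTopology (n : ℕ) (M : Type) [TopologicalSpace M] [ChartedSpace (Euc n) M] :
    TopologicalSpace C^∞⟮𝓡 n, M; ℝ⟯ :=
  TopologicalSpace.generateFrom
    {N | ∃ (f : C^∞⟮𝓡 n, M; ℝ⟯) (r : ℕ) (ι : Type)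
        (ψ : ι → OpenPartialHomeomorph M (Euc n)) (K : ι → Set M) (ε : ι → ℝ),
      (∀ i, ψ i ∈ IsManifold.maximalAtlas (𝓡 n) ∞ M) ∧
      LocallyFinite (fun i => (ψ i).source) ∧
      (∀ i, IsCompact (K i) ∧ K i ⊆ (ψ i).source) ∧
      (∀ i, 0 < ε i) ∧
      N = strongNhd f r ψ K ε}

/-- The Hessian matrix of `h : ℝ^n → ℝ` at `x`. -/
def hessian (h : Euc n → ℝ) (x : Euc n) : Matrix (Fin n) (Fin n) ℝ :=
  Matrix.of fun j k =>
    fderiv ℝ (fderiv ℝ h) x (EuclideanSpace.single j 1) (EuclideanSpace.single k 1)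

/-- `f` has a nondegenerate critical point at `p`: in some smooth chart at `p` the gradient
vanishes and the Hessian matrix is regular. -/
def HasNondegenerateCriticalPointAt (f : M → ℝ) (p : M) : Prop :=
  ∃ ψ ∈ IsManifold.maximalAtlas (𝓡 n) ∞ M, p ∈ ψ.source ∧
    fderiv ℝ (f ∘ ψ.symm) (ψ p) = 0 ∧ IsUnit (hessian (f ∘ ψ.symm) (ψ p))

/-- A smooth function is Morse if all its critical points are nondegenerate. -/
def IsMorse (f : C^∞⟮𝓡 n, M; ℝ⟯) : Prop :=
  ∀ p : M, mfderiv (𝓡 n) 𝓘(ℝ, ℝ) f p = 0 →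
    HasNondegenerateCriticalPointAt (n := n) f p

end Manifold

/-- The `0`-homogeneous extension `Φ(ξ) = φ(ξ / |ξ|)` of a function on the sphere (with the
irrelevant value `0` at the origin). -/
def homogeneousExtension {n : ℕ} (φ : Sph n → ℝ) (ξ : Euc (n + 1)) : ℝ :=
  open Classical in
  if h : ξ ≠ 0 then φ ⟨‖ξ‖⁻¹ • ξ, by simp [norm_smul, norm_ne_zero_iff.mpr h]⟩ else 0

end GenericMultiplier

end

/-! Everything rests on one frequency `ξ₀ ≠ 0` at which the full Hessian of `Φ` is invertible. Let
`f s` have Fourier transform `e^{isΦ} a`, with `a` a bump near `ξ₀`. Then `T^t (f s) = f (s + t)`,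
the `L²` norm of `f s` does not depend on `s`, and `‖f s‖_∞ ≲ ⟨s⟩^{-d/2}` by dispersion.
Interpolating `L²` between `L^p` and `L^∞` makes `‖f t‖_p` large for `p ≤ 2`, which is tested on `f
0 ↦ f t`; for `p ≥ 2` interpolation makes `‖f (-t)‖_p` small, which is tested on `f (-t) ↦ f 0`
(`exists_le_multiplierNorm`).

The dispersive bound (`exists_dispersive_bound`) follows from writing the square of the oscillatory
integral as an integral over shifts `h` of autocorrelations. The linear phase then drops out, and
repeated integration by parts bounds each autocorrelation by powers of `(|t| ‖h‖)⁻¹`.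

Euler's relation gives `D²Φ(ξ) ξ = -DΦ(ξ)`. In the plane this makes the Hessian invertible wherever
`DΦ ≠ 0` (`exists_regular_hessian_of_not_const`). In higher dimension a Morse function has a
critical point, at which only the radial direction is degenerate; a perturbation argument finds
invertible Hessians nearby (`exists_regular_hessian_of_nondegenerate`).

Morse functions are open because nondegeneracy is an open condition on 2-jets and the sphere is
compact. They are dense because `φ + ⟨a, ·⟩` is Morse for almost every small `a`: the bad `a` are
critical values of an explicit map of `ℝ^(n+1)` to itself, so Sard's theorem in equal dimensions
applies. -/

noncomputable section

namespace GenericMultiplier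

open MeasureTheory Set Filter
open scoped FourierTransform

/-! ### Smooth dependence of integrals over `[0, 1]` on a parameter. -/

section ParametricIntegral

variable {H : Type} [NormedAddCommGroup H] [NormedSpace ℝ H] [FiniteDimensional ℝ H]

theorem hasFDerivAt_unitIntervalIntegral {F : Type} [NormedAddCommGroup F] [NormedSpace ℝ F]
    {f : H × ℝ → F} (hf : ContDiff ℝ 1 f) (x₀ : H) :
    HasFDerivAt (fun x => ∫ s in (0 : ℝ)..1, f (x, s))
      (∫ s in (0 : ℝ)..1, (fderiv ℝ f (x₀, s)).comp (ContinuousLinearMap.inl ℝ H ℝ)) x₀ := by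
  have hcont : Continuous fun q : H × ℝ =>
      (fderiv ℝ f q).comp (ContinuousLinearMap.inl ℝ H ℝ) :=
    (hf.continuous_fderiv one_ne_zero).clm_comp continuous_const
  obtain ⟨C, hC⟩ := ((isCompact_closedBall x₀ 1).prod
    (isCompact_Icc (a := (0 : ℝ)) (b := 1))).exists_bound_of_continuousOn hcont.continuousOn
  have hfx : ∀ x, Continuous fun s => f (x, s) := fun x =>
    hf.continuous.comp (Continuous.prodMk_right x)
  refine intervalIntegral.hasFDerivAt_integral_of_dominated_of_fderiv_le
    (F := fun x s => f (x, s))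
    (F' := fun x s => (fderiv ℝ f (x, s)).comp (ContinuousLinearMap.inl ℝ H ℝ))
    (bound := fun _ => C)
    (Metric.closedBall_mem_nhds x₀ one_pos) (Eventually.of_forall fun x => ?_) ?_ ?_ ?_ ?_ ?_
  · exact (hfx x).aestronglyMeasurable
  · exact (hfx x₀).intervalIntegrable _ _
  · exact (hcont.comp (Continuous.prodMk_right x₀)).aestronglyMeasurable
  · refine Eventually.of_forall fun s hs x hx => hC (x, s) ⟨hx, ?_⟩
    rw [uIoc_of_le zero_le_one] at hs
    exact ⟨hs.1.le, hs.2⟩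
  · exact intervalIntegrable_const
  · refine Eventually.of_forall fun s _ x _ => ?_
    exact ((hf.differentiable one_ne_zero (x, s)).hasFDerivAt).comp x
      (hasFDerivAt_prodMk_left x s)

/-- The target space varies in the induction, since the derivative is a parametric integral of the
same kind with values in `H →L[ℝ] F`. -/
theorem contDiff_unitIntervalIntegral_nat (n : ℕ) : ∀ {F : Type} [NormedAddCommGroup F]
    [NormedSpace ℝ F] {f : H × ℝ → F}, ContDiff ℝ ∞ f →
    ContDiff ℝ n (fun x => ∫ s in (0 : ℝ)..1, f (x, s)) := by
  induction n with
  | zero =>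
    intro F _ _ f hf
    exact contDiff_zero.2 (Differentiable.continuous (𝕜 := ℝ) fun x =>
      (hasFDerivAt_unitIntervalIntegral (hf.of_le (by norm_cast)) x).differentiableAt)
  | succ n ih =>
    intro F _ _ f hf
    have hder := hasFDerivAt_unitIntervalIntegral (hf.of_le (by norm_cast))
    push_cast
    refine contDiff_succ_iff_fderiv.2 ⟨fun x => (hder x).differentiableAt, by simp, ?_⟩
    have : fderiv ℝ (fun x => ∫ s in (0 : ℝ)..1, f (x, s)) = fun x =>
        ∫ s in (0 : ℝ)..1, (fderiv ℝ f (x, s)).comp (ContinuousLinearMap.inl ℝ H ℝ) :=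
      funext fun x => (hder x).fderiv
    rw [this]
    exact ih (f := fun q => (fderiv ℝ f q).comp (ContinuousLinearMap.inl ℝ H ℝ))
      ((hf.fderiv_right (m := ∞) (by simp)).clm_comp contDiff_const)

theorem contDiff_unitIntervalIntegral {F : Type} [NormedAddCommGroup F]
    [NormedSpace ℝ F] {f : H × ℝ → F} (hf : ContDiff ℝ ∞ f) :
    ContDiff ℝ ∞ (fun x => ∫ s in (0 : ℝ)..1, f (x, s)) :=
  contDiff_infty.2 fun n => contDiff_unitIntervalIntegral_nat n hf

end ParametricIntegral

/-- A smooth function on `ℝ` that agrees with `x ↦ x⁻¹` for `m ≤ x`. -/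
theorem exists_contDiff_eq_inv {m : ℝ} (hm : 0 < m) :
    ∃ G : ℝ → ℝ, ContDiff ℝ ∞ G ∧ ∀ x, m ≤ x → G x * x = 1 := by
  -- The cutoff vanishes for `x ≤ m / 2`, hence near the singularity of the inverse, and equals `1`
  -- for `m ≤ x`.
  refine ⟨fun x => Real.smoothTransition (2 / m * x - 1) * x⁻¹, ?_, ?_⟩
  · refine contDiff_iff_contDiffAt.2 fun x => ?_
    rcases lt_or_ge x (m / 2) with hx | hx
    · have : (fun x => Real.smoothTransition (2 / m * x - 1) * x⁻¹) =ᶠ[𝓝 x] fun _ => 0 := by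
        filter_upwards [Iio_mem_nhds hx] with y hy
        rw [Real.smoothTransition.zero_of_nonpos, zero_mul]
        have : 2 / m * y ≤ 2 / m * (m / 2) := by gcongr; exact le_of_lt hy
        have h2 : 2 / m * (m / 2) = 1 := by field_simp
        linarith
      exact contDiffAt_const.congr_of_eventuallyEq this
    · have hx0 : x ≠ 0 := by intro h; rw [h] at hx; linarith
      exact (Real.smoothTransition.contDiff.contDiffAt.comp x (by fun_prop)).mul
        (contDiffAt_inv ℝ hx0)
  · intro x hx
    have hx0 : x ≠ 0 := by intro h; rw [h] at hx; linarith
    have : (1 : ℝ) ≤ 2 / m * x - 1 := by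
      have : 2 / m * m ≤ 2 / m * x := by gcongr
      have h2 : 2 / m * m = 2 := by field_simp
      linarith
    simp only
    rw [Real.smoothTransition.one_of_one_le this]
    field_simp

/-! ### Integration by parts in an oscillatory integral. -/

section Dispersive

variable {E : Type} [NormedAddCommGroup E] [InnerProductSpace ℝ E]

/-- One step of integration by parts along the vector field `q ↦ (0, 0, B q.1)`. -/
def amplitudeStep (G : E × ℝ × E → ℝ) (B : E →L[ℝ] E) (b : E × ℝ × E → ℂ) (q : E × ℝ × E) : ℂ :=
  -(fderiv ℝ (fun q => (G q : ℂ) * b q) q (0, 0, B q.1))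

/-- Smoothness is joint in `(w, r, η)`, so that compactness later bounds the iterated amplitudes
uniformly in the direction and length of the shift. -/
theorem contDiff_amplitudeStep {G : E × ℝ × E → ℝ} (hG : ContDiff ℝ ∞ G) (B : E →L[ℝ] E)
    {b : E × ℝ × E → ℂ} (hb : ContDiff ℝ ∞ b) : ContDiff ℝ ∞ (amplitudeStep G B b) := by
  have h1 : ContDiff ℝ ∞ fun q => (G q : ℂ) * b q :=
    (Complex.ofRealCLM.contDiff.comp hG).mul hb
  refine ContDiff.neg ((h1.fderiv_right (m := ∞) (by simp)).clm_apply ?_)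
  fun_prop

theorem amplitudeStep_eq_slice {G : E × ℝ × E → ℝ} (hG : ContDiff ℝ ∞ G) (B : E →L[ℝ] E)
    {b : E × ℝ × E → ℂ} (hb : ContDiff ℝ ∞ b) (w : E) (r : ℝ) (η : E) :
    amplitudeStep G B b (w, r, η) =
      -(fderiv ℝ (fun η => (G (w, r, η) : ℂ) * b (w, r, η)) η (B w)) := by
  have h1 : ContDiff ℝ ∞ fun q => (G q : ℂ) * b q :=
    (Complex.ofRealCLM.contDiff.comp hG).mul hb
  have h2 : HasFDerivAt (fun η : E => (w, r, η))
      ((ContinuousLinearMap.inr ℝ E (ℝ × E)).comp (ContinuousLinearMap.inr ℝ ℝ E)) η :=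
    (hasFDerivAt_prodMk_right w (r, η)).comp η (hasFDerivAt_prodMk_right r η)
  have h3 := ((h1.differentiable (by simp) (w, r, η)).hasFDerivAt).comp η h2
  have h4 := h3.fderiv
  simp only [Function.comp_def] at h4
  rw [amplitudeStep, h4]
  simp

theorem amplitudeStep_eq_zero {G : E × ℝ × E → ℝ} (hG : ContDiff ℝ ∞ G) (B : E →L[ℝ] E)
    {b : E × ℝ × E → ℂ} (hb : ContDiff ℝ ∞ b) (w : E) (r : ℝ) {S : Set E} (hS : IsClosed S)
    (hbS : ∀ η ∉ S, b (w, r, η) = 0) (η : E) (hη : η ∉ S) :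
    amplitudeStep G B b (w, r, η) = 0 := by
  rw [amplitudeStep_eq_slice hG B hb]
  have : (fun η => (G (w, r, η) : ℂ) * b (w, r, η)) =ᶠ[𝓝 η] fun _ => 0 := by
    filter_upwards [hS.isOpen_compl.mem_nhds hη] with y hy
    rw [hbS y hy, mul_zero]
  rw [this.fderiv_eq]
  simp

variable [FiniteDimensional ℝ E] [MeasurableSpace E] [BorelSpace E]

theorem integrable_of_continuous_of_forall_notMem {u : E → ℂ} (hu : Continuous u)
    {S : Set E} (hS : IsCompact S) (huS : ∀ η ∉ S, u η = 0) : Integrable u :=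
  hu.integrable_of_hasCompactSupport (HasCompactSupport.intro hS huS)

/-- On the support of `b`, `G` inverts `g`, so `i c e^{iψ} b` is the derivative of `e^{iψ}` along `B
w` times `G b`; integrate by parts. Keeping `c` as a factor instead of dividing by it allows `c =
0`. -/
theorem integral_cexp_mul_amplitudeStep {G g : E × ℝ × E → ℝ} (hG : ContDiff ℝ ∞ G)
    (B : E →L[ℝ] E) {b : E × ℝ × E → ℂ} (hb : ContDiff ℝ ∞ b) (w : E) (r : ℝ) {S : Set E}
    (hS : IsCompact S) (hbS : ∀ η ∉ S, b (w, r, η) = 0) {ψ : E → ℝ} (hψ : ContDiff ℝ ∞ ψ)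
    {c : ℝ} (hψg : ∀ η, fderiv ℝ ψ η (B w) = c * g (w, r, η))
    (hGg : ∀ η ∈ S, G (w, r, η) * g (w, r, η) = 1) :
    ∫ η, Complex.exp (Complex.I * ψ η) * amplitudeStep G B b (w, r, η) =
      (Complex.I * c) * ∫ η, Complex.exp (Complex.I * ψ η) * b (w, r, η) := by
  set e : E → ℂ := fun η => Complex.exp (Complex.I * ψ η) with he
  set k : E → ℂ := fun η => (G (w, r, η) : ℂ) * b (w, r, η) with hk
  have hψc : ContDiff ℝ ∞ fun η => (ψ η : ℂ) := Complex.ofRealCLM.contDiff.comp hψ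
  have hec : ContDiff ℝ ∞ e := (contDiff_const.mul hψc).cexp
  have hkc : ContDiff ℝ ∞ k := by
    have : ContDiff ℝ ∞ fun q => (G q : ℂ) * b q :=
      (Complex.ofRealCLM.contDiff.comp hG).mul hb
    exact this.comp (contDiff_const.prodMk (contDiff_const.prodMk contDiff_id))
  have hkS : ∀ η ∉ S, k η = 0 := fun η hη => by simp [hk, hbS η hη]
  have hk'S : ∀ η ∉ S, fderiv ℝ k η (B w) = 0 := fun η hη => by
    have := amplitudeStep_eq_zero hG B hb w r hS.isClosed hbS η hη
    rwa [amplitudeStep_eq_slice hG B hb, neg_eq_zero] at this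
  have hed : ∀ η, fderiv ℝ e η (B w) = e η * (Complex.I * (c * g (w, r, η) : ℝ)) := fun η => by
    have h1 : HasFDerivAt (fun η => (ψ η : ℂ)) (Complex.ofRealCLM.comp (fderiv ℝ ψ η)) η :=
      Complex.ofRealCLM.hasFDerivAt.comp η (hψ.differentiable (by simp) η).hasFDerivAt
    have h2 := ((h1.const_mul Complex.I).cexp).fderiv
    rw [he, h2]
    simp [hψg]
  have hfe : Continuous fun η => fderiv ℝ e η (B w) :=
    (hec.continuous_fderiv (by simp)).clm_apply continuous_const
  have hfk : Continuous fun η => fderiv ℝ k η (B w) :=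
    (hkc.continuous_fderiv (by simp)).clm_apply continuous_const
  have hIBP := integral_mul_fderiv_eq_neg_fderiv_mul_of_integrable (μ := volume) (f := e) (g := k)
    (v := B w)
    (integrable_of_continuous_of_forall_notMem (hfe.mul hkc.continuous) hS
      fun η hη => by simp [hkS η hη])
    (integrable_of_continuous_of_forall_notMem (hec.continuous.mul hfk) hS
      fun η hη => by simp [hk'S η hη])
    (integrable_of_continuous_of_forall_notMem (hec.continuous.mul hkc.continuous) hS
      fun η hη => by simp [hkS η hη])
    (fun η _ => hec.differentiable (by simp) η) (fun η _ => hkc.differentiable (by simp) η)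
  have h1 : ∫ η, e η * amplitudeStep G B b (w, r, η) = -∫ η, e η * fderiv ℝ k η (B w) := by
    rw [← integral_neg]
    refine integral_congr_ae (Eventually.of_forall fun η => ?_)
    simp only [amplitudeStep_eq_slice hG B hb, mul_neg]
    rfl
  rw [h1, hIBP, neg_neg, ← integral_const_mul]
  refine integral_congr_ae (Eventually.of_forall fun η => ?_)
  simp only [hed]
  by_cases hη : η ∈ S
  · have : (G (w, r, η) : ℂ) * (g (w, r, η) : ℂ) = 1 := by exact_mod_cast hGg η hη
    simp only [hk]
    push_cast
    linear_combination (e η * Complex.I * c * b (w, r, η)) * this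
  · simp [hkS η hη, hbS η hη]

end Dispersive

/-! ### Averaged Hessians and the decay of autocorrelations. -/

section Dispersive

variable {E : Type} [NormedAddCommGroup E] [InnerProductSpace ℝ E]

/-- The averaged second derivative `∫₀¹ D²Φ(η + s r w)(w, B w) ds`, as a function of
`(w, r, η)`. -/
def averagedHessian (Φ : E → ℝ) (B : E →L[ℝ] E) (q : E × ℝ × E) : ℝ :=
  ∫ s in (0 : ℝ)..1, fderiv ℝ (fderiv ℝ Φ) (q.2.2 + (s * q.2.1) • q.1) q.1 (B q.1)

theorem contDiff_averagedHessian [FiniteDimensional ℝ E] {Φ : E → ℝ} (hΦ : ContDiff ℝ ∞ Φ)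
    (B : E →L[ℝ] E) : ContDiff ℝ ∞ (averagedHessian Φ B) := by
  have h2 : ContDiff ℝ ∞ (fderiv ℝ (fderiv ℝ Φ)) :=
    (hΦ.fderiv_right (m := ∞) (by simp)).fderiv_right (m := ∞) (by simp)
  refine contDiff_unitIntervalIntegral (H := E × ℝ × E) (f := fun x =>
    fderiv ℝ (fderiv ℝ Φ) (x.1.2.2 + (x.2 * x.1.2.1) • x.1.1) x.1.1 (B x.1.1)) ?_
  refine ((h2.comp ?_).clm_apply ?_).clm_apply ?_ <;> fun_prop

theorem fderiv_sub_eq_mul_averagedHessian {Φ : E → ℝ} (hΦ : ContDiff ℝ ∞ Φ)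
    (B : E →L[ℝ] E) (w : E) (r : ℝ) (η : E) :
    fderiv ℝ Φ (η + r • w) (B w) - fderiv ℝ Φ η (B w) = r * averagedHessian Φ B (w, r, η) := by
  have h1 : ContDiff ℝ ∞ (fderiv ℝ Φ) := hΦ.fderiv_right (m := ∞) (by simp)
  have h2 : Continuous (fderiv ℝ (fderiv ℝ Φ)) := h1.continuous_fderiv (by simp)
  have hd : ∀ s : ℝ, HasDerivAt (fun s : ℝ => fderiv ℝ Φ (η + (s * r) • w) (B w))
      (r * fderiv ℝ (fderiv ℝ Φ) (η + (s * r) • w) w (B w)) s := by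
    intro s
    have hl : HasDerivAt (fun s : ℝ => η + (s * r) • w) (r • w) s := by
      simpa using (((hasDerivAt_id s).mul_const r).smul_const w).const_add η
    have := ((h1.differentiable (by simp) _).hasFDerivAt.comp_hasDerivAt s hl).clm_apply
      (hasDerivAt_const s (B w))
    simpa using this
  have hc : Continuous fun s : ℝ => r * fderiv ℝ (fderiv ℝ Φ) (η + (s * r) • w) w (B w) := by
    refine continuous_const.mul (((h2.comp ?_).clm_apply continuous_const).clm_apply
      continuous_const)
    fun_prop
  have := intervalIntegral.integral_eq_sub_of_hasDerivAt (a := 0) (b := 1) (fun s _ => hd s)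
    (hc.intervalIntegrable _ _)
  rw [intervalIntegral.integral_const_mul] at this
  simp only [one_mul, zero_mul, zero_smul, add_zero] at this
  rw [averagedHessian, this]

variable [FiniteDimensional ℝ E]

/-- The vector `v` with `⟨v, ·⟩ = A w`. -/
def rieszVector (A : E →L[ℝ] E →L[ℝ] ℝ) : E →L[ℝ] E :=
  ((InnerProductSpace.toDual ℝ E).symm.toContinuousLinearEquiv.toContinuousLinearMap).comp A

theorem apply_rieszVector (A : E →L[ℝ] E →L[ℝ] ℝ) (w : E) :
    A w (rieszVector A w) = ‖A w‖ ^ 2 := by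
  have h : A w = InnerProductSpace.toDual ℝ E (rieszVector A w) := by
    simp [rieszVector]
  have h2 : ‖A w‖ = ‖rieszVector A w‖ := by rw [h, LinearIsometryEquiv.norm_map]
  rw [h2, h, InnerProductSpace.toDual_apply_apply, real_inner_self_eq_norm_sq]

/-- The Hessian `A` at `ξ₀` may be indefinite, so `w` itself is not a usable direction. With `B` the
Riesz representative of `A`, `A w (B w) = ‖A w‖²` is positive on the unit sphere. Half of its
minimum survives in a small ball, which is convex and so contains the segment of averaging. -/
theorem exists_le_averagedHessian {Φ : E → ℝ} (hΦ : ContDiff ℝ ∞ Φ) (ξ₀ : E)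
    (hinj : ∀ w, fderiv ℝ (fderiv ℝ Φ) ξ₀ w = 0 → w = 0) :
    ∃ B : E →L[ℝ] E, ∃ m > 0, ∃ δ > 0, ∀ (w : E) (r : ℝ) (η : E), ‖w‖ = 1 →
      η ∈ Metric.closedBall ξ₀ δ → η + r • w ∈ Metric.closedBall ξ₀ δ →
      m ≤ averagedHessian Φ B (w, r, η) := by
  set B := rieszVector (fderiv ℝ (fderiv ℝ Φ) ξ₀) with hB
  have h2 : Continuous (fderiv ℝ (fderiv ℝ Φ)) :=
    (hΦ.fderiv_right (m := ∞) (by simp)).continuous_fderiv (by simp)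
  have hc : Continuous fun z : E × E => fderiv ℝ (fderiv ℝ Φ) z.1 z.2 (B z.2) :=
    ((h2.comp continuous_fst).clm_apply continuous_snd).clm_apply (by fun_prop)
  obtain ⟨m, hm, hmle⟩ := (isCompact_sphere (0 : E) 1).exists_forall_le' (a := 0)
    (f := fun w => fderiv ℝ (fderiv ℝ Φ) ξ₀ w (B w))
    (hc.comp (Continuous.prodMk_right ξ₀)).continuousOn (fun w hw => by
      rw [hB, apply_rieszVector]
      have : fderiv ℝ (fderiv ℝ Φ) ξ₀ w ≠ 0 := fun h => by
        have := hinj w h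
        simp [this] at hw
      positivity)
  have hev : ∀ᶠ ξ in 𝓝 ξ₀, ∀ w ∈ Metric.sphere (0 : E) 1,
      m / 2 < fderiv ℝ (fderiv ℝ Φ) ξ w (B w) := by
    refine (isCompact_sphere (0 : E) 1).eventually_forall_of_forall_eventually fun w hw => ?_
    exact hc.continuousAt.eventually (lt_mem_nhds (by
      have := hmle w hw
      simp only at this ⊢
      linarith))
  obtain ⟨δ, hδ, hball⟩ := Metric.nhds_basis_closedBall.eventually_iff.1 hev
  refine ⟨B, m / 2, by positivity, δ, hδ, fun w r η hw hη hηr => ?_⟩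
  have hint : Continuous fun s : ℝ =>
      fderiv ℝ (fderiv ℝ Φ) (η + (s * r) • w) w (B w) := by
    refine ((h2.comp ?_).clm_apply continuous_const).clm_apply continuous_const
    fun_prop
  have : ∫ s in (0 : ℝ)..1, m / 2 ≤ averagedHessian Φ B (w, r, η) := by
    refine intervalIntegral.integral_mono_on zero_le_one intervalIntegrable_const
      (hint.intervalIntegrable _ _) fun s hs => (hball ?_ w (by simpa using hw)).le
    have := (convex_closedBall ξ₀ δ) hη hηr (sub_nonneg.2 hs.2) hs.1 (by ring)
    convert! this using 1
    module
  simpa using this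

variable [MeasurableSpace E] [BorelSpace E]

/-- Along `B w`, with `h = r w`, the phase has derivative `t r` times the averaged Hessian, which is
at least `m` on the support. Each integration by parts therefore gains a factor `(|t| ‖h‖)⁻¹`. The
radius `δ` is fixed before `a` and `N`. -/
theorem exists_bound_correlation [Nontrivial E] {Φ : E → ℝ} (hΦ : ContDiff ℝ ∞ Φ) (ξ₀ : E)
    (hinj : ∀ w, fderiv ℝ (fderiv ℝ Φ) ξ₀ w = 0 → w = 0) :
    ∃ δ > 0, ∀ a : E → ℂ, ContDiff ℝ ∞ a → (∀ ξ ∉ Metric.closedBall ξ₀ δ, a ξ = 0) →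
      ∀ N : ℕ, ∃ C, ∀ (t : ℝ) (h : E), (|t| * ‖h‖) ^ N *
        ‖∫ η, Complex.exp (Complex.I * (t * (Φ (η + h) - Φ η) : ℝ)) *
          (a (η + h) * (starRingEnd ℂ) (a η))‖ ≤ C := by
  obtain ⟨B, m, hm, δ, hδ, hle⟩ := exists_le_averagedHessian hΦ ξ₀ hinj
  refine ⟨δ, hδ, fun a ha haδ N => ?_⟩
  obtain ⟨G₀, hG₀, hG₀inv⟩ := exists_contDiff_eq_inv hm
  set G : E × ℝ × E → ℝ := fun q => G₀ (averagedHessian Φ B q) with hGdef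
  have hG : ContDiff ℝ ∞ G := hG₀.comp (contDiff_averagedHessian hΦ B)
  set b₀ : E × ℝ × E → ℂ := fun q => a (q.2.2 + q.2.1 • q.1) * (starRingEnd ℂ) (a q.2.2)
    with hb₀def
  have hb₀ : ContDiff ℝ ∞ b₀ := by
    refine (ha.comp (by fun_prop)).mul (Complex.conjCLE.contDiff.comp (ha.comp (by fun_prop)))
  set b : ℕ → E × ℝ × E → ℂ := fun k => (amplitudeStep G B)^[k] b₀ with hbdef
  have hbsucc : ∀ k, b (k + 1) = amplitudeStep G B (b k) := fun k =>
    Function.iterate_succ_apply' _ _ _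
  have hb : ∀ k, ContDiff ℝ ∞ (b k) := by
    intro k
    induction k with
    | zero => exact hb₀
    | succ k ih => rw [hbsucc]; exact contDiff_amplitudeStep hG B ih
  set S : E → ℝ → Set E := fun w r =>
    Metric.closedBall ξ₀ δ ∩ (fun η => η + r • w) ⁻¹' Metric.closedBall ξ₀ δ with hSdef
  have hS : ∀ w r, IsCompact (S w r) := fun w r =>
    (isCompact_closedBall ξ₀ δ).inter_right (Metric.isClosed_closedBall.preimage (by fun_prop))
  have hbS : ∀ k w r, ∀ η ∉ S w r, b k (w, r, η) = 0 := by
    intro k w r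
    induction k with
    | zero =>
      intro η hη
      by_cases h1 : η ∈ Metric.closedBall ξ₀ δ
      · have h2 : η + r • w ∉ Metric.closedBall ξ₀ δ := fun h2 => hη ⟨h1, h2⟩
        simp [hbdef, hb₀def, haδ _ h2]
      · simp [hbdef, hb₀def, haδ _ h1]
    | succ k ih =>
      rw [hbsucc]
      exact amplitudeStep_eq_zero hG B (hb k) w r (hS w r).isClosed ih
  -- Lengths up to `2 * δ` suffice: the amplitude vanishes unless `η` and `η + r • w` both lie in
  -- the ball of radius `δ`.
  obtain ⟨C, hC⟩ := ((isCompact_sphere (0 : E) 1).prod ((isCompact_Icc (a := (0 : ℝ))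
    (b := 2 * δ)).prod (isCompact_closedBall ξ₀ δ))).exists_bound_of_continuousOn
    (hb N).continuous.continuousOn
  refine ⟨C * volume.real (Metric.closedBall ξ₀ δ), fun t h => ?_⟩
  obtain ⟨w, hw, hhw⟩ : ∃ w : E, ‖w‖ = 1 ∧ h = ‖h‖ • w := by
    rcases eq_or_ne h 0 with rfl | hh
    · obtain ⟨w, hw⟩ := exists_norm_eq E zero_le_one
      exact ⟨w, hw, by simp⟩
    · have : ‖h‖ ≠ 0 := norm_ne_zero_iff.2 hh
      exact ⟨‖h‖⁻¹ • h, by simp [norm_smul, this], by simp [smul_smul, this]⟩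
  set r := ‖h‖ with hr
  have hr0 : 0 ≤ r := norm_nonneg h
  set ψ : E → ℝ := fun η => t * (Φ (η + h) - Φ η) with hψdef
  have hψ : ContDiff ℝ ∞ ψ :=
    contDiff_const.mul ((hΦ.comp (contDiff_id.add contDiff_const)).sub hΦ)
  have hψg : ∀ η, fderiv ℝ ψ η (B w) = (t * r) * averagedHessian Φ B (w, r, η) := by
    intro η
    have h1 : HasFDerivAt ψ (t • (fderiv ℝ Φ (η + h) - fderiv ℝ Φ η)) η := by
      refine HasFDerivAt.const_mul (HasFDerivAt.sub ?_
        (hΦ.differentiable (by simp) η).hasFDerivAt) t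
      exact (hasFDerivAt_comp_add_right h).2 (hΦ.differentiable (by simp) (η + h)).hasFDerivAt
    rw [h1.fderiv, mul_assoc, ← fderiv_sub_eq_mul_averagedHessian hΦ B w r η, ← hhw]
    simp
  have hstep : ∀ k, ∫ η, Complex.exp (Complex.I * ψ η) * b k (w, r, η) =
      (Complex.I * (t * r : ℝ)) ^ k * ∫ η, Complex.exp (Complex.I * ψ η) * b 0 (w, r, η) := by
    intro k
    induction k with
    | zero => simp
    | succ k ih =>
      rw [hbsucc, integral_cexp_mul_amplitudeStep hG B (hb k) w r (hS w r) (hbS k w r) hψ hψg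
        (fun η hη => hG₀inv _ (hle w r η hw hη.1 hη.2)), ih, pow_succ]
      ring
  have h0 : ∫ η, Complex.exp (Complex.I * (t * (Φ (η + h) - Φ η) : ℝ)) *
      (a (η + h) * (starRingEnd ℂ) (a η)) =
      ∫ η, Complex.exp (Complex.I * ψ η) * b 0 (w, r, η) := by
    simp only [hbdef, hb₀def, Function.iterate_zero, id, ← hhw, hψdef]
  have hN := congrArg norm (hstep N)
  rw [norm_mul, norm_pow, norm_mul, Complex.norm_I, one_mul, Complex.norm_real, Real.norm_eq_abs,
    abs_mul, abs_of_nonneg hr0] at hN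
  rw [h0, ← hN]
  have hC0 : ∀ η ∈ Metric.closedBall ξ₀ δ, ‖Complex.exp (Complex.I * ψ η) * b N (w, r, η)‖ ≤ C := by
    intro η hη
    rw [norm_mul, mul_comm Complex.I, Complex.norm_exp_ofReal_mul_I, one_mul]
    by_cases hηS : η ∈ S w r
    · refine hC (w, r, η) ⟨by simpa using hw, ⟨hr0, ?_⟩, hη⟩
      have h1 : dist (η + r • w) η ≤ δ + δ :=
        (dist_triangle_right _ _ ξ₀).trans (add_le_add hηS.2 hηS.1)
      rw [← hhw, dist_eq_norm] at h1
      simp only [add_sub_cancel_left] at h1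
      linarith
    · rw [hbS N w r η hηS, norm_zero]
      refine (norm_nonneg _).trans (hC (w, 0, ξ₀) ⟨by simpa using hw, ⟨le_rfl, by positivity⟩, ?_⟩)
      simp [hδ.le]
  rw [← setIntegral_eq_integral_of_forall_compl_eq_zero (s := Metric.closedBall ξ₀ δ)
    (fun η hη => by rw [hbS N w r η (fun h => hη h.1), mul_zero])]
  exact norm_setIntegral_le_of_norm_le_const measure_closedBall_lt_top hC0

/-- Expand the square as a double integral and substitute `ξ = η + h`; Fubini gives equality before
the norm is taken inside. -/
theorem norm_integral_sq_le {u : E → ℂ} (hu : Integrable u) :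
    ‖∫ ξ, u ξ‖ ^ 2 ≤ ∫ h, ‖∫ η, u (η + h) * (starRingEnd ℂ) (u η)‖ := by
  have hprod : Integrable (fun z : E × E => u z.1 * (starRingEnd ℂ) (u z.2))
      ((volume : Measure E).prod volume) := by
    have hu' : Integrable fun ξ => (starRingEnd ℂ) (u ξ) :=
      (Complex.conjCLE : ℂ ≃L[ℝ] ℂ).toContinuousLinearMap.integrable_comp hu
    exact hu.mul_prod hu'
  have hshift : Integrable (fun z : E × E => u (z.2 + z.1) * (starRingEnd ℂ) (u z.2))
      ((volume : Measure E).prod volume) := by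
    have hmp := measurePreserving_add_prod (G := E) volume volume
    have := hmp.integrable_comp_of_integrable hprod
    simpa only [Function.comp_def, add_comm] using this
  have h1 : ((‖∫ ξ, u ξ‖ ^ 2 : ℝ) : ℂ) =
      ∫ h, ∫ η, u (η + h) * (starRingEnd ℂ) (u η) := by
    rw [integral_integral_swap hshift]
    have : ∀ η : E, ∫ h, u (η + h) * (starRingEnd ℂ) (u η) =
        (∫ ξ, u ξ) * (starRingEnd ℂ) (u η) := fun η => by
      rw [integral_mul_const, integral_add_left_eq_self]
    simp_rw [this]
    rw [integral_const_mul, integral_conj, Complex.mul_conj, Complex.normSq_eq_norm_sq]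
  have h2 : ‖∫ ξ, u ξ‖ ^ 2 = ‖∫ h, ∫ η, u (η + h) * (starRingEnd ℂ) (u η)‖ := by
    rw [← h1, Complex.norm_real]
    simp
  rw [h2]
  exact norm_integral_le_integral_norm _

end Dispersive

/-! ### The dispersive estimate. -/

theorem one_le_japanese (t : ℝ) : 1 ≤ japanese t := by
  rw [japanese, Real.one_le_sqrt]
  nlinarith [sq_nonneg |t|]

theorem japanese_le_one_add_abs (t : ℝ) : japanese t ≤ 1 + |t| := by
  rw [japanese, Real.sqrt_le_left (by positivity)]
  nlinarith [abs_nonneg t]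

theorem japanese_neg (t : ℝ) : japanese (-t) = japanese t := by simp [japanese]

section Dispersive

variable {E : Type} [NormedAddCommGroup E] [InnerProductSpace ℝ E] [FiniteDimensional ℝ E]
  [MeasurableSpace E] [BorelSpace E]

theorem one_add_pow_le (x : ℝ) (hx : 0 ≤ x) (n : ℕ) : (1 + x) ^ n ≤ 2 ^ n * (1 + x ^ n) := by
  calc (1 + x) ^ n ≤ (2 * max 1 x) ^ n := by
        gcongr
        rcases le_total 1 x with h | h <;> simp [h] <;> linarith
    _ = 2 ^ n * (max 1 x) ^ n := mul_pow _ _ _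
    _ ≤ 2 ^ n * (1 + x ^ n) := by
        gcongr
        rcases le_total 1 x with h | h
        · simp [h]
        · simp [h, pow_nonneg hx]

theorem integral_one_add_abs_mul_norm_rpow (t : ℝ) (r : ℝ) :
    ∫ h : E, (1 + |t| * ‖h‖) ^ (-r) =
      (|t| ^ Module.finrank ℝ E)⁻¹ * ∫ h : E, (1 + ‖h‖) ^ (-r) := by
  have := Measure.integral_comp_smul (volume : Measure E) (fun h : E => (1 + ‖h‖) ^ (-r)) t
  simp only [norm_smul, Real.norm_eq_abs, abs_inv, abs_pow, smul_eq_mul] at this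
  exact this

theorem integrable_one_add_abs_mul_norm_rpow {t : ℝ} (ht : t ≠ 0) {r : ℝ}
    (hr : (Module.finrank ℝ E : ℝ) < r) :
    Integrable fun h : E => (1 + |t| * ‖h‖) ^ (-r) := by
  have := (integrable_one_add_norm (E := E) (μ := volume) hr).comp_smul ht
  simpa only [norm_smul, Real.norm_eq_abs] using this

/-- Dispersive estimate: near a point where the Hessian of the phase is regular, the oscillatory
integral with phase `t Φ` and an arbitrary linear perturbation decays like `⟨t⟩ ^ (-d / 2)`. -/
theorem exists_dispersive_bound [Nontrivial E] {Φ : E → ℝ} (hΦ : ContDiff ℝ ∞ Φ) (ξ₀ : E)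
    (hinj : ∀ w, fderiv ℝ (fderiv ℝ Φ) ξ₀ w = 0 → w = 0) :
    ∃ δ > 0, ∀ a : E → ℂ, ContDiff ℝ ∞ a → (∀ ξ ∉ Metric.closedBall ξ₀ δ, a ξ = 0) →
      ∃ C, ∀ (t : ℝ) (x : E),
        ‖∫ ξ, Complex.exp (Complex.I * (t * Φ ξ + inner ℝ ξ x : ℝ)) * a ξ‖ ^ 2 *
          japanese t ^ Module.finrank ℝ E ≤ C := by
  obtain ⟨δ, hδ, hcorr⟩ := exists_bound_correlation hΦ ξ₀ hinj
  refine ⟨δ, hδ, fun a ha haδ => ?_⟩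
  set d := Module.finrank ℝ E with hd
  obtain ⟨C₀, hC₀⟩ := hcorr a ha haδ 0
  -- The order `d + 1` is the first to give a majorant `(1 + |t| ‖h‖)^{-(d+1)}` integrable in `h`;
  -- its integral scales like `|t|^{-d}`.
  obtain ⟨C₁, hC₁⟩ := hcorr a ha haδ (d + 1)
  set J : ℝ → E → ℂ := fun t h =>
    ∫ η, Complex.exp (Complex.I * (t * (Φ (η + h) - Φ η) : ℝ)) *
      (a (η + h) * (starRingEnd ℂ) (a η)) with hJ
  have haint : Integrable a := integrable_of_continuous_of_forall_notMem ha.continuous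
    (isCompact_closedBall ξ₀ δ) haδ
  have hJle : ∀ t h, ‖J t h‖ ≤
      (2 ^ (d + 1) * (C₀ + C₁)) * (1 + |t| * ‖h‖) ^ (-((d + 1 : ℕ) : ℝ)) := by
    intro t h
    have hx : 0 ≤ |t| * ‖h‖ := by positivity
    have h0 := hC₀ t h
    have h1 := hC₁ t h
    rw [pow_zero, one_mul] at h0
    rw [Real.rpow_neg (by positivity), Real.rpow_natCast, ← div_eq_mul_inv, le_div_iff₀
      (by positivity)]
    calc ‖J t h‖ * (1 + |t| * ‖h‖) ^ (d + 1)
        ≤ ‖J t h‖ * (2 ^ (d + 1) * (1 + (|t| * ‖h‖) ^ (d + 1))) := by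
          gcongr
          exact one_add_pow_le _ hx _
      _ = 2 ^ (d + 1) * (‖J t h‖ + (|t| * ‖h‖) ^ (d + 1) * ‖J t h‖) := by ring
      _ ≤ 2 ^ (d + 1) * (C₀ + C₁) := by
          gcongr
  have hlin : ∀ (t : ℝ) (x : E),
      Integrable fun ξ => Complex.exp (Complex.I * (t * Φ ξ + inner ℝ ξ x : ℝ)) * a ξ := by
    intro t x
    refine integrable_of_continuous_of_forall_notMem (Continuous.mul ?_ ha.continuous)
      (isCompact_closedBall ξ₀ δ) fun ξ hξ => by rw [haδ ξ hξ, mul_zero]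
    have := hΦ.continuous
    fun_prop
  set K := ∫ h : E, (1 + ‖h‖) ^ (-((d + 1 : ℕ) : ℝ)) with hK
  have hsq : ∀ (t : ℝ) (x : E), t ≠ 0 →
      ‖∫ ξ, Complex.exp (Complex.I * (t * Φ ξ + inner ℝ ξ x : ℝ)) * a ξ‖ ^ 2 * |t| ^ d ≤
        2 ^ (d + 1) * (C₀ + C₁) * K := by
    intro t x ht
    have h1 := norm_integral_sq_le (hlin t x)
    -- The linear phase contributes only `e^{i⟨h, x⟩}`, which is unimodular and constant in `η`;
    -- hence the uniformity in `x`.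
    have h2 : ∀ h : E, ‖∫ η, (Complex.exp (Complex.I * (t * Φ (η + h) + inner ℝ (η + h) x : ℝ)) *
        a (η + h)) * (starRingEnd ℂ) (Complex.exp (Complex.I * (t * Φ η + inner ℝ η x : ℝ)) * a η)‖
        = ‖J t h‖ := by
      intro h
      have : ∀ η, (Complex.exp (Complex.I * (t * Φ (η + h) + inner ℝ (η + h) x : ℝ)) *
        a (η + h)) * (starRingEnd ℂ) (Complex.exp (Complex.I * (t * Φ η + inner ℝ η x : ℝ)) * a η)
        = Complex.exp (Complex.I * (inner ℝ h x : ℝ)) *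
          (Complex.exp (Complex.I * (t * (Φ (η + h) - Φ η) : ℝ)) *
          (a (η + h) * (starRingEnd ℂ) (a η))) := by
        intro η
        rw [map_mul, ← Complex.exp_conj, map_mul, Complex.conj_I, Complex.conj_ofReal,
          ← mul_assoc (Complex.exp _) (Complex.exp _), ← Complex.exp_add,
          mul_mul_mul_comm, ← Complex.exp_add]
        congr 2
        rw [inner_add_left]
        push_cast
        ring
      simp_rw [this]
      rw [integral_const_mul, norm_mul, mul_comm Complex.I, Complex.norm_exp_ofReal_mul_I, one_mul]
    simp_rw [h2] at h1
    have hr : (d : ℝ) < ((d + 1 : ℕ) : ℝ) := by push_cast; linarith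
    have h3 : ∫ h, ‖J t h‖ ≤ 2 ^ (d + 1) * (C₀ + C₁) * ((|t| ^ d)⁻¹ * K) := by
      rw [hK, ← integral_one_add_abs_mul_norm_rpow, ← integral_const_mul]
      exact integral_mono_of_nonneg (Eventually.of_forall fun h => norm_nonneg _)
        ((integrable_one_add_abs_mul_norm_rpow ht hr).const_mul _)
        (Eventually.of_forall fun h => hJle t h)
    have ht' : 0 < |t| ^ d := by positivity
    calc _ ≤ 2 ^ (d + 1) * (C₀ + C₁) * ((|t| ^ d)⁻¹ * K) * |t| ^ d := by
          gcongr; exact h1.trans h3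
      _ = 2 ^ (d + 1) * (C₀ + C₁) * K := by field_simp
  -- The trivial bound covers small `|t|`; added to the bound with `|t| ^ d` it turns `|t|` into
  -- `⟨t⟩`.
  have htriv : ∀ (t : ℝ) (x : E),
      ‖∫ ξ, Complex.exp (Complex.I * (t * Φ ξ + inner ℝ ξ x : ℝ)) * a ξ‖ ≤ ∫ ξ, ‖a ξ‖ := by
    intro t x
    refine (norm_integral_le_integral_norm _).trans_eq (integral_congr_ae
      (Eventually.of_forall fun ξ => ?_))
    simp only
    rw [norm_mul, mul_comm Complex.I, Complex.norm_exp_ofReal_mul_I, one_mul]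
  have hdpos : d ≠ 0 := Module.finrank_pos.ne'
  have hC₀' : 0 ≤ C₀ := le_trans (by positivity) (hC₀ 0 0)
  have hC₁' : 0 ≤ C₁ := le_trans (by positivity) (hC₁ 0 0)
  have hKpos : 0 ≤ K := integral_nonneg fun h => by positivity
  refine ⟨2 ^ d * ((∫ ξ, ‖a ξ‖) ^ 2 + 2 ^ (d + 1) * (C₀ + C₁) * K), fun t x => ?_⟩
  set I := ∫ ξ, Complex.exp (Complex.I * (t * Φ ξ + inner ℝ ξ x : ℝ)) * a ξ with hI
  have hIt : ‖I‖ ^ 2 * |t| ^ d ≤ 2 ^ (d + 1) * (C₀ + C₁) * K := by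
    rcases eq_or_ne t 0 with rfl | ht
    · simp only [abs_zero, ne_eq, hdpos, not_false_eq_true, zero_pow, mul_zero]
      positivity
    · exact hsq t x ht
  have hI1 : ‖I‖ ^ 2 ≤ (∫ ξ, ‖a ξ‖) ^ 2 := by gcongr; exact htriv t x
  calc ‖I‖ ^ 2 * japanese t ^ d ≤ ‖I‖ ^ 2 * (2 ^ d * (1 + |t| ^ d)) := by
        gcongr
        refine le_trans (pow_le_pow_left₀ (zero_le_one.trans (one_le_japanese t))
          (japanese_le_one_add_abs t) d) (one_add_pow_le _ (abs_nonneg t) d)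
    _ = 2 ^ d * (‖I‖ ^ 2 + ‖I‖ ^ 2 * |t| ^ d) := by ring
    _ ≤ _ := by gcongr

end Dispersive

/-! ### From dispersion to lower bounds for the multiplier norm. -/

theorem fourierHat_eq_fourier {d : ℕ} (f : Euc d → ℂ) (ξ : Euc d) :
    fourierHat f ξ = (1 / (2 * (Real.pi : ℂ)) ^ d) * 𝓕 f ((2 * Real.pi)⁻¹ • ξ) := by
  rw [fourierHat, Real.fourier_eq']
  congr 1
  refine integral_congr_ae (Eventually.of_forall fun x => ?_)
  simp only [smul_eq_mul]
  rw [mul_comm, real_inner_comm, inner_smul_right]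
  congr 2
  have : (Real.pi : ℂ) ≠ 0 := by exact_mod_cast Real.pi_ne_zero
  push_cast
  field_simp

/-- Substituting `ξ = 2π w` passes to the Fourier convention of Mathlib; the Jacobian cancels the
factor `(2π)^{-d}`. -/
theorem multiplierOp_eq_integral {d : ℕ} (Φ : Euc d → ℝ) (t : ℝ) (f : 𝓢(Euc d, ℂ)) (x : Euc d) :
    multiplierOp Φ t f x = ∫ w : Euc d,
      Complex.exp (Complex.I * (t * Φ ((2 * Real.pi) • w) + inner ℝ w ((2 * Real.pi) • x) : ℝ)) *
        𝓕 f w := by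
  have hpi : (2 * Real.pi) ≠ 0 := by positivity
  have hpc : (2 * (Real.pi : ℂ)) ≠ 0 := by exact_mod_cast hpi
  have h := Measure.integral_comp_smul (volume : Measure (Euc d)) (fun w : Euc d =>
    (1 / (2 * (Real.pi : ℂ)) ^ d) *
      (Complex.exp (Complex.I * (t * Φ ((2 * Real.pi) • w) + inner ℝ w ((2 * Real.pi) • x) : ℝ)) *
        𝓕 f w)) (2 * Real.pi)⁻¹
  have hl : multiplierOp Φ t f x = ∫ ξ : Euc d, (fun w : Euc d =>
    (1 / (2 * (Real.pi : ℂ)) ^ d) *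
      (Complex.exp (Complex.I * (t * Φ ((2 * Real.pi) • w) + inner ℝ w ((2 * Real.pi) • x) : ℝ)) *
        𝓕 f w)) ((2 * Real.pi)⁻¹ • ξ) := by
    rw [multiplierOp]
    refine integral_congr_ae (Eventually.of_forall fun ξ => ?_)
    simp only
    rw [fourierHat_eq_fourier, smul_inv_smul₀ hpi, real_inner_smul_left, real_inner_smul_right,
      inv_mul_cancel_left₀ hpi, SchwartzMap.fourier_coe, mul_left_comm, ← mul_add]
    push_cast
    rfl
  rw [hl, h, integral_const_mul, Complex.real_smul, ← mul_assoc]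
  have : (((|(((2 * Real.pi)⁻¹) ^ Module.finrank ℝ (Euc d))⁻¹| : ℝ) : ℂ)) *
      (1 / (2 * (Real.pi : ℂ)) ^ d) = 1 := by
    rw [abs_of_nonneg (by positivity), finrank_euclideanSpace_fin, inv_pow, inv_inv]
    push_cast
    field_simp
  rw [this, one_mul]

/-- The oscillatory estimates need a phase smooth on the whole space, while `Φ` is singular at the
origin. The condition `r < ‖ξ₀‖` keeps the origin out of the ball. -/
theorem exists_cutoff {d : ℕ} {Φ : Euc d → ℝ} (hΦ : ContDiffOn ℝ ∞ Φ {0}ᶜ) {ξ₀ : Euc d}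
    (hξ₀ : ξ₀ ≠ 0) : ∃ Ψ : Euc d → ℝ, ContDiff ℝ ∞ Ψ ∧ ∃ r > 0, r < ‖ξ₀‖ ∧
      ∀ ξ ∈ Metric.closedBall ξ₀ r, Ψ ξ = Φ ξ := by
  have hpos : 0 < ‖ξ₀‖ := norm_pos_iff.2 hξ₀
  let χ : ContDiffBump ξ₀ := ⟨‖ξ₀‖ / 4, ‖ξ₀‖ / 2, by positivity, by linarith⟩
  refine ⟨fun ξ => χ ξ * Φ ξ, ?_, ‖ξ₀‖ / 4, by positivity, by linarith, fun ξ hξ => ?_⟩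
  · refine contDiff_iff_contDiffAt.2 fun ξ => ?_
    rcases eq_or_ne ξ 0 with rfl | hξ
    · have : (fun ξ => χ ξ * Φ ξ) =ᶠ[𝓝 0] fun _ => 0 := by
        filter_upwards [Metric.ball_mem_nhds (0 : Euc d) (half_pos hpos)] with y hy
        rw [χ.zero_of_le_dist, zero_mul]
        change ‖ξ₀‖ / 2 ≤ dist y ξ₀
        have h1 := dist_triangle_left (0 : Euc d) ξ₀ y
        rw [Metric.mem_ball] at hy
        rw [dist_zero_left] at h1
        linarith
      exact contDiffAt_const.congr_of_eventuallyEq this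
    · exact χ.contDiffAt.mul (hΦ.contDiffAt (isOpen_compl_singleton.mem_nhds hξ))
  · simp only
    rw [χ.one_of_mem_closedBall hξ, one_mul]

/-- A one-parameter orbit of Schwartz functions under the multipliers, of constant positive `L²`
norm, and with dispersive decay. -/
theorem exists_dispersive_orbit {d : ℕ} {Φ : Euc d → ℝ}
    (hΦ : IsSmoothZeroHomogeneous Φ)
    {ξ₀ : Euc d} (hξ₀ : ξ₀ ≠ 0) (hinj : ∀ w, fderiv ℝ (fderiv ℝ Φ) ξ₀ w = 0 → w = 0) :
    ∃ (f : ℝ → 𝓢(Euc d, ℂ)) (A C : ℝ), 0 < A ∧ (∀ s t x, multiplierOp Φ t (f s) x = f (s + t) x) ∧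
      (∀ s, ∫ x, ‖f s x‖ ^ 2 = A) ∧ ∀ s x, ‖f s x‖ ^ 2 * japanese s ^ d ≤ C := by
  obtain ⟨Ψ, hΨ, r, hr, hrlt, hΨΦ⟩ := exists_cutoff hΦ.smooth hξ₀
  have hnt : Nontrivial (Euc d) := ⟨ξ₀, 0, hξ₀⟩
  have hinj' : ∀ w, fderiv ℝ (fderiv ℝ Ψ) ξ₀ w = 0 → w = 0 := by
    have : Ψ =ᶠ[𝓝 ξ₀] Φ := by
      filter_upwards [Metric.closedBall_mem_nhds ξ₀ hr] with ξ hξ using hΨΦ ξ hξ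
    rwa [this.fderiv.fderiv_eq]
  obtain ⟨δ, hδ, hdisp⟩ := exists_dispersive_bound hΨ ξ₀ hinj'
  -- Inside radius `δ` the dispersive bound applies, inside radius `r` the phases `Ψ` and `Φ` agree.
  let χ : ContDiffBump ξ₀ := ⟨min δ r / 2, min δ r, by positivity, by
    have : 0 < min δ r := lt_min hδ hr
    linarith⟩
  set a : Euc d → ℂ := fun ξ => (χ ξ : ℂ) with ha
  have hasmooth : ContDiff ℝ ∞ a := Complex.ofRealCLM.contDiff.comp χ.contDiff
  have ha0 : ∀ ξ ∉ Metric.closedBall ξ₀ (min δ r), a ξ = 0 := fun ξ hξ => by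
    rw [Metric.mem_closedBall, not_le] at hξ
    simp [ha, χ.zero_of_le_dist hξ.le]
  obtain ⟨C, hC⟩ := hdisp a hasmooth fun ξ hξ => ha0 ξ fun h =>
    hξ (Metric.closedBall_subset_closedBall (min_le_left _ _) h)
  set m : ℝ → Euc d → ℂ := fun s ξ => Complex.exp (Complex.I * (s * Ψ ξ : ℝ)) * a ξ with hm
  have hmsmooth : ∀ s, ContDiff ℝ ∞ (m s) := fun s =>
    (contDiff_const.mul (Complex.ofRealCLM.contDiff.comp (contDiff_const.mul hΨ))).cexp.mul hasmooth
  have hmsupp : ∀ s, HasCompactSupport (m s) := fun s =>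
    HasCompactSupport.intro (isCompact_closedBall ξ₀ (min δ r)) fun ξ hξ => by
      simp [hm, ha0 ξ hξ]
  set M : ℝ → 𝓢(Euc d, ℂ) := fun s => (hmsupp s).toSchwartzMap (hmsmooth s) with hM
  have hMm : ∀ s ξ, M s ξ = m s ξ := fun s ξ => rfl
  have hf : ∀ s, 𝓕 (𝓕⁻ (M s)) = M s := fun s => FourierTransform.fourier_fourierInv_eq (M s)
  have hfx : ∀ s x, (𝓕⁻ (M s)) x =
      ∫ ξ, Complex.exp (Complex.I * (s * Ψ ξ + inner ℝ ξ ((2 * Real.pi) • x) : ℝ)) * a ξ := by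
    intro s x
    rw [SchwartzMap.fourierInv_coe, Real.fourierInv_eq']
    refine integral_congr_ae (Eventually.of_forall fun ξ => ?_)
    simp only [smul_eq_mul]
    rw [hMm, hm, ← mul_assoc, ← Complex.exp_add, real_inner_smul_right]
    congr 2
    push_cast
    ring
  refine ⟨fun s => 𝓕⁻ (M s), ∫ ξ, ‖a ξ‖ ^ 2, C, ?_, fun s t x => ?_, fun s => ?_, fun s x => ?_⟩
  · have hcont : Continuous fun ξ => ‖a ξ‖ ^ 2 := by
      have := hasmooth.continuous
      fun_prop
    refine hcont.integral_pos_of_hasCompactSupport_nonneg_nonzero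
      (HasCompactSupport.intro (isCompact_closedBall ξ₀ (min δ r)) fun ξ hξ => by simp [ha0 ξ hξ])
      (fun ξ => by positivity) (x := ξ₀) ?_
    have : χ ξ₀ = 1 := χ.one_of_mem_closedBall (by simp [χ.rIn_pos.le])
    simp [ha, this]
  · rw [multiplierOp_eq_integral, hf, hfx]
    refine integral_congr_ae (Eventually.of_forall fun ξ => ?_)
    simp only
    rw [hMm, hm]
    by_cases hξ : ξ ∈ Metric.closedBall ξ₀ (min δ r)
    · have hξr : ξ ∈ Metric.closedBall ξ₀ r :=
        Metric.closedBall_subset_closedBall (min_le_right _ _) hξ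
      have hξ0 : ξ ≠ 0 := by
        rintro rfl
        rw [Metric.mem_closedBall, dist_zero_left] at hξr
        linarith
      -- Homogeneity removes the dilation by `2π` left over from the change of Fourier convention.
      rw [hΦ.homogeneous _ (by positivity) ξ hξ0, ← hΨΦ ξ hξr, ← mul_assoc, ← Complex.exp_add]
      congr 2
      push_cast
      ring
    · simp [ha0 ξ hξ]
  · rw [← SchwartzMap.integral_norm_sq_fourier, hf]
    refine integral_congr_ae (Eventually.of_forall fun ξ => ?_)
    simp only
    rw [hMm, hm, norm_mul, mul_comm Complex.I, Complex.norm_exp_ofReal_mul_I, one_mul]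
  · have := hC s ((2 * Real.pi) • x)
    rw [finrank_euclideanSpace_fin] at this
    simp only
    rwa [hfx]

theorem eLpNorm_schwartz_eq {d : ℕ} (f : 𝓢(Euc d, ℂ)) {p : ℝ} (hp : 0 < p) :
    eLpNorm (fun x => f x) (ENNReal.ofReal p) volume =
      ENNReal.ofReal ((∫ x, ‖f x‖ ^ p) ^ (1 / p)) := by
  rw [(f.memLp (ENNReal.ofReal p) volume).eLpNorm_eq_integral_rpow_norm
    (by simpa using hp) ENNReal.ofReal_ne_top, ENNReal.toReal_ofReal hp.le, one_div]

theorem integrable_norm_rpow_schwartz {d : ℕ} (f : 𝓢(Euc d, ℂ)) {p : ℝ} (hp : 0 < p) :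
    Integrable fun x => ‖f x‖ ^ p := by
  have := (f.memLp (ENNReal.ofReal p) volume).integrable_norm_rpow
    (by simpa using hp) ENNReal.ofReal_ne_top
  rwa [ENNReal.toReal_ofReal hp.le] at this

theorem le_multiplierNorm {d : ℕ} {Φ : Euc d → ℝ} {t p : ℝ} (hp : 0 < p) {f g : 𝓢(Euc d, ℂ)}
    (hfg : ∀ x, multiplierOp Φ t f x = g x) (hf : 0 < ∫ x, ‖f x‖ ^ p) :
    ENNReal.ofReal ((∫ x, ‖g x‖ ^ p) ^ (1 / p) / (∫ x, ‖f x‖ ^ p) ^ (1 / p)) ≤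
      multiplierNorm Φ t p := by
  have hf0 : f ≠ 0 := by
    rintro rfl
    simp [Real.zero_rpow hp.ne'] at hf
  rw [ENNReal.ofReal_div_of_pos (by positivity), ← eLpNorm_schwartz_eq f hp,
    ← eLpNorm_schwartz_eq g hp, ← funext hfg]
  exact le_iSup₂ (f := fun (f : 𝓢(Euc d, ℂ)) (_ : f ≠ 0) =>
    eLpNorm (multiplierOp Φ t f) (ENNReal.ofReal p) volume /
      eLpNorm (fun x => f x) (ENNReal.ofReal p) volume) f hf0

/-- Comparing `‖f s‖_p^p` with `‖f s‖_2² ‖f s‖_∞^{p-2}` gives a lower bound for `p ≤ 2` and an upper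
bound for `p ≥ 2`, in both cases with the power `⟨s⟩^{d(1/p - 1/2)}`. -/
theorem exists_le_multiplierNorm {d : ℕ} {Φ : Euc d → ℝ}
    (hΦ : IsSmoothZeroHomogeneous Φ) {ξ₀ : Euc d} (hξ₀ : ξ₀ ≠ 0)
    (hinj : ∀ w, fderiv ℝ (fderiv ℝ Φ) ξ₀ w = 0 → w = 0) {p : ℝ} (hp : 1 < p) :
    ∃ c : ℝ, 0 < c ∧ ∀ t : ℝ,
      ENNReal.ofReal (c * japanese t ^ ((d : ℝ) * |1 / 2 - 1 / p|)) ≤ multiplierNorm Φ t p := by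
  obtain ⟨f, A, C, hA, hT, hL2, hdisp⟩ := exists_dispersive_orbit hΦ hξ₀ hinj
  have hp0 : 0 < p := by linarith
  set n : ℝ → ℝ := fun s => ∫ x, ‖f s x‖ ^ p with hn
  have hnpos : ∀ s, 0 < n s := by
    intro s
    refine lt_of_le_of_ne (integral_nonneg fun x => by positivity) fun h => ?_
    rw [hn, eq_comm, integral_eq_zero_iff_of_nonneg (fun x => by positivity)
      (integrable_norm_rpow_schwartz (f s) hp0)] at h
    have : ∫ x, ‖f s x‖ ^ 2 = 0 := by
      refine integral_eq_zero_of_ae ?_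
      filter_upwards [h] with x hx
      simp only [Pi.zero_apply] at hx ⊢
      rw [Real.rpow_eq_zero (norm_nonneg _) hp0.ne'] at hx
      simp [hx]
    rw [hL2 s] at this
    exact hA.ne' this
  have hjpos : ∀ s, 0 < japanese s := fun s => zero_lt_one.trans_le (one_le_japanese s)
  set K : ℝ := Real.sqrt (max C 1) with hK
  have hKpos : 0 < K := Real.sqrt_pos.2 (lt_max_of_lt_right one_pos)
  have hsup : ∀ s x, ‖f s x‖ ≤ K * japanese s ^ (-((d : ℝ) / 2)) := by
    intro s x
    refine le_of_sq_le_sq ?_ (by have := hjpos s; positivity)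
    rw [mul_pow, hK, Real.sq_sqrt (by positivity), ← Real.rpow_natCast (_ ^ _), ← Real.rpow_mul
      (hjpos s).le]
    have : -((d : ℝ) / 2) * ((2 : ℕ) : ℝ) = -(d : ℝ) := by push_cast; ring
    rw [this, Real.rpow_neg (hjpos s).le, Real.rpow_natCast, ← div_eq_mul_inv, le_div_iff₀
      (pow_pos (hjpos s) d)]
    exact (hdisp s x).trans (le_max_left _ _)
  set Q : ℝ → ℝ := fun s => K * japanese s ^ (-((d : ℝ) / 2)) with hQ
  have hQpos : ∀ s, 0 < Q s := fun s => by have := hjpos s; positivity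
  have hpow : ∀ s, (A * Q s ^ (p - 2)) ^ (1 / p) =
      (A ^ (1 / p) * K ^ (1 - 2 / p)) * japanese s ^ ((d : ℝ) * (1 / p - 1 / 2)) := by
    intro s
    have hj := hjpos s
    rw [Real.mul_rpow hA.le (by have := hQpos s; positivity), ← Real.rpow_mul (hQpos s).le, hQ,
      Real.mul_rpow hKpos.le (by positivity), ← Real.rpow_mul hj.le, mul_assoc]
    congr 3
    · field_simp
    · field_simp
      ring
  set D : ℝ := A ^ (1 / p) * K ^ (1 - 2 / p) with hD
  have hDpos : 0 < D := by positivity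
  have hint2 : ∀ s, Integrable fun x => ‖f s x‖ ^ (2 : ℕ) := fun s => by
    have := integrable_norm_rpow_schwartz (f s) (two_pos)
    simpa only [Real.rpow_two] using this
  rcases le_total p 2 with hp2 | hp2
  -- For `p ≤ 2` the orbit spreads out: the input is `f 0` and the output `f t` has large `L^p`
  -- norm.
  · refine ⟨D / n 0 ^ (1 / p), by have := hnpos 0; positivity, fun t => ?_⟩
    have hle : A * Q t ^ (p - 2) ≤ n t := by
      have hQ2 : 0 < Q t ^ (2 - p) := Real.rpow_pos_of_pos (hQpos t) _
      have h1 : A ≤ Q t ^ (2 - p) * n t := by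
        rw [← hL2 t, hn, ← integral_const_mul]
        refine integral_mono (hint2 t) ((integrable_norm_rpow_schwartz (f t) hp0).const_mul _)
          fun x => ?_
        simp only
        rw [← Real.rpow_two]
        have : ‖f t x‖ ^ (2 : ℝ) = ‖f t x‖ ^ (2 - p) * ‖f t x‖ ^ p := by
          rw [← Real.rpow_add_of_nonneg (norm_nonneg _) (by linarith) hp0.le]
          congr 1
          ring
        rw [this]
        gcongr
        exact hsup t x
      have h2 : Q t ^ (p - 2) = (Q t ^ (2 - p))⁻¹ := by
        rw [← Real.rpow_neg (hQpos t).le]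
        congr 1
        ring
      rw [h2, ← div_eq_mul_inv, div_le_iff₀ hQ2, mul_comm]
      exact h1
    refine le_trans (ENNReal.ofReal_le_ofReal ?_) (le_multiplierNorm hp0 (f := f 0) (g := f t)
      (fun x => by rw [hT, zero_add]) (hnpos 0))
    have habs : |1 / 2 - 1 / p| = 1 / p - 1 / 2 := by
      rw [abs_sub_comm, abs_of_nonneg]
      rw [sub_nonneg]
      exact one_div_le_one_div_of_le hp0 hp2
    rw [habs, div_mul_eq_mul_div, ← hpow]
    have := hnpos 0
    have := hQpos t
    gcongr
  -- For `p ≥ 2` the orbit refocuses: the input `f (-t)` has small `L^p` norm and the output is the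
  -- fixed `f 0`.
  · refine ⟨n 0 ^ (1 / p) / D, by have := hnpos 0; positivity, fun t => ?_⟩
    have hle : n (-t) ≤ A * Q (-t) ^ (p - 2) := by
      rw [← hL2 (-t), hn, ← integral_mul_const]
      refine integral_mono (integrable_norm_rpow_schwartz (f (-t)) hp0)
        ((hint2 (-t)).mul_const _) fun x => ?_
      simp only
      rw [← Real.rpow_two]
      have : ‖f (-t) x‖ ^ p = ‖f (-t) x‖ ^ (2 : ℝ) * ‖f (-t) x‖ ^ (p - 2) := by
        rw [← Real.rpow_add_of_nonneg (norm_nonneg _) (by norm_num) (by linarith)]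
        congr 1
        ring
      rw [this]
      gcongr
      exact hsup (-t) x
    refine le_trans (ENNReal.ofReal_le_ofReal ?_) (le_multiplierNorm hp0 (f := f (-t)) (g := f 0)
      (fun x => by rw [hT, neg_add_cancel]) (hnpos (-t)))
    have habs : |1 / 2 - 1 / p| = -(1 / p - 1 / 2) := by
      rw [abs_of_nonneg]
      · ring
      rw [sub_nonneg]
      exact one_div_le_one_div_of_le two_pos hp2
    have hj := hjpos t
    have h0 := hnpos 0
    have h1 : n (-t) ^ (1 / p) ≤ D * japanese t ^ ((d : ℝ) * (1 / p - 1 / 2)) := by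
      rw [← japanese_neg t, ← hpow]
      have := hnpos (-t)
      gcongr
    have h2 : n 0 ^ (1 / p) / D * japanese t ^ ((d : ℝ) * |1 / 2 - 1 / p|) =
        n 0 ^ (1 / p) / (D * japanese t ^ ((d : ℝ) * (1 / p - 1 / 2))) := by
      rw [habs, mul_neg, Real.rpow_neg hj.le]
      field_simp
    rw [h2]
    have := hnpos (-t)
    change _ ≤ n 0 ^ (1 / p) / n (-t) ^ (1 / p)
    gcongr

/-! ### Euler relations and points with invertible Hessian. -/

namespace IsSmoothZeroHomogeneous

variable {d : ℕ} {Φ : Euc d → ℝ}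

theorem contDiffAt (hΦ : IsSmoothZeroHomogeneous Φ) {ξ : Euc d} (hξ : ξ ≠ 0) :
    ContDiffAt ℝ ∞ Φ ξ :=
  hΦ.smooth.contDiffAt (isOpen_compl_singleton.mem_nhds hξ)

theorem contDiffAt_fderiv (hΦ : IsSmoothZeroHomogeneous Φ) {ξ : Euc d} (hξ : ξ ≠ 0) :
    ContDiffAt ℝ ∞ (fderiv ℝ Φ) ξ :=
  (hΦ.contDiffAt hξ).fderiv_right (by simp)

theorem contDiffAt_fderiv_fderiv (hΦ : IsSmoothZeroHomogeneous Φ) {ξ : Euc d} (hξ : ξ ≠ 0) :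
    ContDiffAt ℝ ∞ (fderiv ℝ (fderiv ℝ Φ)) ξ :=
  (hΦ.contDiffAt_fderiv hξ).fderiv_right (by simp)

theorem fderiv_fderiv_comm (hΦ : IsSmoothZeroHomogeneous Φ) {ξ : Euc d} (hξ : ξ ≠ 0)
    (v w : Euc d) :
    fderiv ℝ (fderiv ℝ Φ) ξ v w = fderiv ℝ (fderiv ℝ Φ) ξ w v :=
  (hΦ.contDiffAt hξ).isSymmSndFDerivAt (by simp; exact WithTop.coe_le_coe.2 le_top) v w

theorem fderiv_self (hΦ : IsSmoothZeroHomogeneous Φ) {ξ : Euc d} (hξ : ξ ≠ 0) :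
    fderiv ℝ Φ ξ ξ = 0 := by
  have h1 : HasDerivAt (fun r : ℝ => r • ξ) ξ 1 := by
    simpa using (hasDerivAt_id (1 : ℝ)).smul_const ξ
  have h2 : HasDerivAt (fun r : ℝ => Φ (r • ξ)) (fderiv ℝ Φ ξ ξ) 1 := by
    have h3 : HasFDerivAt Φ (fderiv ℝ Φ ξ) ((1 : ℝ) • ξ) := by
      rw [one_smul]
      exact ((hΦ.contDiffAt hξ).differentiableAt (by simp)).hasFDerivAt
    exact h3.comp_hasDerivAt (1 : ℝ) h1
  have h3 : HasDerivAt (fun r : ℝ => Φ (r • ξ)) 0 1 := by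
    refine (hasDerivAt_const (1 : ℝ) (Φ ξ)).congr_of_eventuallyEq ?_
    filter_upwards [Ioi_mem_nhds (zero_lt_one' ℝ)] with r hr
    exact hΦ.homogeneous r hr ξ hξ
  exact h2.unique h3

/-- Differentiate Euler's relation `DΦ(η) η = 0` with respect to `η`. -/
theorem fderiv_fderiv_apply_self (hΦ : IsSmoothZeroHomogeneous Φ) {ξ : Euc d} (hξ : ξ ≠ 0)
    (z : Euc d) : fderiv ℝ (fderiv ℝ Φ) ξ z ξ = -fderiv ℝ Φ ξ z := by
  have h1 := (((hΦ.contDiffAt_fderiv hξ).differentiableAt (by simp)).hasFDerivAt).clm_apply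
    (hasFDerivAt_id ξ)
  have h2 : HasFDerivAt (fun η => fderiv ℝ Φ η η) (0 : Euc d →L[ℝ] ℝ) ξ := by
    refine (hasFDerivAt_const (0 : ℝ) ξ).congr_of_eventuallyEq ?_
    filter_upwards [isOpen_compl_singleton.mem_nhds hξ] with η hη
    exact hΦ.fderiv_self hη
  have h3 := congrArg (fun L => L z) (h1.unique h2)
  simp at h3
  linarith

theorem fderiv_fderiv_self (hΦ : IsSmoothZeroHomogeneous Φ) {ξ : Euc d} (hξ : ξ ≠ 0) :
    fderiv ℝ (fderiv ℝ Φ) ξ ξ = -fderiv ℝ Φ ξ := by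
  ext z
  rw [hΦ.fderiv_fderiv_comm hξ, hΦ.fderiv_fderiv_apply_self hξ]
  rfl

end IsSmoothZeroHomogeneous

/-- Take `ξ` with `DΦ(ξ) ≠ 0`, which exists because the punctured plane is connected. A vector in
the kernel of the Hessian is annihilated by `DΦ(ξ)`, by Euler, so it is a multiple `c ξ`. But the
Hessian sends `c ξ` to `-c DΦ(ξ)`, forcing `c = 0`. -/
theorem exists_regular_hessian_of_not_const {Φ : Euc 2 → ℝ} (hΦ : IsSmoothZeroHomogeneous Φ)
    (hnc : ¬ ∃ a : ℝ, ∀ ξ : Euc 2, ξ ≠ 0 → Φ ξ = a) :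
    ∃ ξ : Euc 2, ξ ≠ 0 ∧ ∀ w, fderiv ℝ (fderiv ℝ Φ) ξ w = 0 → w = 0 := by
  obtain ⟨ξ, hξ, hd⟩ : ∃ ξ : Euc 2, ξ ≠ 0 ∧ fderiv ℝ Φ ξ ≠ 0 := by
    by_contra! hcon
    refine hnc ?_
    have hrank : 1 < Module.rank ℝ (Euc 2) := by
      rw [← Module.finrank_eq_rank, finrank_euclideanSpace_fin]
      norm_num
    have hconn : IsPreconnected ({0}ᶜ : Set (Euc 2)) :=
      (isConnected_compl_singleton_of_one_lt_rank hrank 0).isPreconnected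
    obtain ⟨a, ha⟩ := isOpen_compl_singleton.exists_is_const_of_fderiv_eq_zero hconn
      (hΦ.smooth.differentiableOn (by simp)) (fun ξ hξ => hcon ξ hξ)
    exact ⟨a, fun ξ hξ => ha ξ hξ⟩
  refine ⟨ξ, hξ, fun w hw => ?_⟩
  have h1 : fderiv ℝ Φ ξ w = 0 := by
    have := hΦ.fderiv_fderiv_apply_self hξ w
    rw [hw] at this
    simpa using this.symm
  have hker : Module.finrank ℝ (LinearMap.ker (fderiv ℝ Φ ξ).toLinearMap) = 1 := by
    have := Module.Dual.finrank_ker_add_one_of_ne_zero (K := ℝ) (V₁ := Euc 2)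
      (f := (fderiv ℝ Φ ξ).toLinearMap) (fun h => hd (by ext z; exact congrArg (fun L => L z) h))
    rw [finrank_euclideanSpace_fin] at this
    omega
  have hξk : (⟨ξ, hΦ.fderiv_self hξ⟩ : LinearMap.ker (fderiv ℝ Φ ξ).toLinearMap) ≠ 0 :=
    fun h => hξ (congrArg Subtype.val h)
  obtain ⟨c, hc⟩ := (finrank_eq_one_iff_of_nonzero' _ hξk).1 hker ⟨w, h1⟩
  have hc' : c • ξ = w := congrArg Subtype.val hc
  rw [← hc', map_smul, hΦ.fderiv_fderiv_self hξ, smul_neg, neg_eq_zero, smul_eq_zero] at hw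
  rcases hw with h | h
  · rw [← hc', h, zero_smul]
  · exact absurd h hd

/-- Near a critical point whose Hessian is regular transversally to the radial direction, there are
points with regular Hessian. -/
theorem exists_regular_hessian_of_nondegenerate {d : ℕ} {Φ : Euc d → ℝ}
    (hΦ : IsSmoothZeroHomogeneous Φ) {p : Euc d} (hp : ‖p‖ = 1) (hcrit : fderiv ℝ Φ p = 0)
    (hnd : ∀ z, inner ℝ p z = 0 → fderiv ℝ (fderiv ℝ Φ) p z = 0 → z = 0)
    (hz : ∃ z : Euc d, inner ℝ p z = 0 ∧ z ≠ 0) :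
    ∃ ξ : Euc d, ξ ≠ 0 ∧ ∀ w, fderiv ℝ (fderiv ℝ Φ) ξ w = 0 → w = 0 := by
  have hp0 : p ≠ 0 := fun h => by simp [h] at hp
  set A := fderiv ℝ (fderiv ℝ Φ) p with hA
  have hsymm : ∀ v w, A v w = A w v := hΦ.fderiv_fderiv_comm hp0
  have hAp : A p = 0 := by rw [hA, hΦ.fderiv_fderiv_self hp0, hcrit, neg_zero]
  -- By polarization, as `A` is symmetric and nonzero on the directions orthogonal to `p`.
  obtain ⟨u, hu⟩ : ∃ u, A u u ≠ 0 := by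
    by_contra! hcon
    obtain ⟨z, hz1, hz2⟩ := hz
    refine hz2 (hnd z hz1 ?_)
    ext w
    have h1 := hcon (z + w)
    simp only [map_add, add_apply, hcon z, hcon w, hsymm w z] at h1
    simp only [zero_apply]
    linarith
  by_contra! hcon
  set P : Euc d →L[ℝ] ℝ := innerSL ℝ p with hP
  -- Suppose all Hessians are singular. Since `A` kills only the line of `p`, the rank-one term
  -- makes `N 0` invertible, and hence `N ε` for small `ε`.
  set N : ℝ → Euc d →L[ℝ] Euc d →L[ℝ] ℝ := fun ε =>
    fderiv ℝ (fderiv ℝ Φ) (p + ε • u) + P.smulRight P with hN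
  have hline : HasDerivAt (fun ε : ℝ => p + ε • u) u 0 := by
    simpa using ((hasDerivAt_id (0 : ℝ)).smul_const u).const_add p
  have hD1 : HasDerivAt (fun ε : ℝ => fderiv ℝ Φ (p + ε • u)) (A u) 0 := by
    have h1 : HasFDerivAt (fderiv ℝ Φ) A (p + (0 : ℝ) • u) := by
      rw [zero_smul, add_zero]
      exact ((hΦ.contDiffAt_fderiv hp0).differentiableAt (by simp)).hasFDerivAt
    exact h1.comp_hasDerivAt (0 : ℝ) hline
  have hD2 : ContDiffAt ℝ 1 (fun ε : ℝ => fderiv ℝ (fderiv ℝ Φ) (p + ε • u)) 0 := by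
    have h1 : ContDiffAt ℝ 1 (fderiv ℝ (fderiv ℝ Φ)) (p + (0 : ℝ) • u) := by
      rw [zero_smul, add_zero]
      exact (hΦ.contDiffAt_fderiv_fderiv hp0).of_le (by simp)
    exact h1.comp (0 : ℝ) (by fun_prop)
  have hN0 : N 0 = A + P.smulRight P := by simp [hN, hA]
  have hPp : P p = 1 := by simp [hP, hp]
  have hN0inj : Function.Injective (N 0) := by
    rw [injective_iff_map_eq_zero]
    intro z hz0
    rw [hN0] at hz0
    have h1 := congrArg (fun L => L p) hz0
    simp only [add_apply, ContinuousLinearMap.smulRight_apply,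
      smul_apply, hsymm z p, hAp, zero_apply, hPp,
      smul_eq_mul, mul_one, zero_add] at h1
    refine hnd z (by simpa [hP] using h1) ?_
    simpa [h1] using hz0
  obtain ⟨e, he⟩ : ∃ e : Euc d ≃L[ℝ] (Euc d →L[ℝ] ℝ), (e : Euc d →L[ℝ] Euc d →L[ℝ] ℝ) = N 0 := by
    have hfin : Module.finrank ℝ (Euc d) = Module.finrank ℝ (Euc d →L[ℝ] ℝ) :=
      (InnerProductSpace.toDual ℝ (Euc d)).toLinearEquiv.finrank_eq
    refine ⟨(LinearEquiv.ofInjectiveOfFinrankEq (N 0).toLinearMap hN0inj hfin).toContinuousLinearEquiv, ?_⟩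
    ext z w
    rfl
  have hNd : ContDiffAt ℝ 1 N 0 := hD2.add contDiffAt_const
  -- A kernel vector `w` of the Hessian satisfies `N ε w = P w • P`, so it is a multiple of `W ε`.
  -- Thus `W` is a differentiable choice of kernel vectors with `W 0 = p`.
  set W : ℝ → Euc d := fun ε => (N ε).inverse P with hW
  have hWd : DifferentiableAt ℝ W 0 := by
    have h1 : ContDiffAt ℝ 1 (ContinuousLinearMap.inverse :
        (Euc d →L[ℝ] Euc d →L[ℝ] ℝ) → _) (N 0) := by
      rw [← he]
      exact contDiffAt_map_inverse e
    exact ((h1.comp (0 : ℝ) hNd).clm_apply contDiffAt_const).differentiableAt one_ne_zero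
  have hequiv : ∀ᶠ ε in 𝓝 (0 : ℝ), ∃ e' : Euc d ≃L[ℝ] (Euc d →L[ℝ] ℝ),
      (e' : Euc d →L[ℝ] Euc d →L[ℝ] ℝ) = N ε := by
    have := ContinuousLinearEquiv.nhds e
    rw [he] at this
    exact hNd.continuousAt.eventually this
  have hne : ∀ᶠ ε in 𝓝 (0 : ℝ), p + ε • u ≠ 0 := by
    have : Tendsto (fun ε : ℝ => p + ε • u) (𝓝 0) (𝓝 p) := by
      simpa using hline.continuousAt.tendsto
    exact this.eventually (isOpen_compl_singleton.mem_nhds hp0)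
  have hWker : ∀ᶠ ε in 𝓝 (0 : ℝ), fderiv ℝ (fderiv ℝ Φ) (p + ε • u) (W ε) = 0 := by
    filter_upwards [hequiv, hne] with ε ⟨e', he'⟩ hε
    obtain ⟨w, hw, hw0⟩ := hcon _ hε
    have h1 : N ε w = P w • P := by simp [hN, hw]
    have h2 : w = P w • W ε := by
      have h3 : W ε = e'.symm P := by
        simp only [hW]
        rw [← he', ContinuousLinearMap.inverse_equiv]
        rfl
      have h4 : e' w = P w • P := by rw [← h1, ← he']; rfl
      rw [h3, ← map_smul, ← h4, e'.symm_apply_apply]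
    have h3 : P w ≠ 0 := fun h => hw0 (by rw [h2, h, zero_smul])
    rw [h2, map_smul, smul_eq_zero] at hw
    exact hw.resolve_left h3
  have hW0 : W 0 = p := by
    have h1 : N 0 p = P := by simp [hN0, hAp, hPp]
    simp only [hW]
    rw [← he, ContinuousLinearMap.inverse_equiv]
    have h4 : e p = P := by rw [← h1, ← he]; rfl
    change e.symm P = p
    rw [← h4, e.symm_apply_apply]
  set y : ℝ → Euc d := fun ε => W ε - (p + ε • u) with hy
  have hy0 : y 0 = 0 := by simp [hy, hW0]
  obtain ⟨z, hyd⟩ : ∃ z, HasDerivAt y z 0 :=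
    ⟨_, (hWd.sub hline.differentiableAt).hasDerivAt⟩
  have hα : ∀ᶠ ε in 𝓝 (0 : ℝ), fderiv ℝ (fderiv ℝ Φ) (p + ε • u) (y ε) =
      fderiv ℝ Φ (p + ε • u) := by
    filter_upwards [hWker, hne] with ε hε hε0
    rw [hy, map_sub, hε, hΦ.fderiv_fderiv_self hε0]
    simp
  have hβ : ∀ᶠ ε in 𝓝 (0 : ℝ), fderiv ℝ Φ (p + ε • u) (y ε) = 0 := by
    filter_upwards [hWker, hne] with ε hε hε0
    have h1 := hΦ.fderiv_fderiv_apply_self hε0 (W ε)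
    rw [hε] at h1
    rw [hy, map_sub, hΦ.fderiv_self hε0, sub_zero]
    simpa using h1.symm
  -- Differentiate `hα` at `0`; the term with the derivative of the Hessian drops out because `y 0 =
  -- 0`.
  have hAz : A z = A u := by
    have h1 := (hD2.differentiableAt one_ne_zero).hasDerivAt.clm_apply hyd
    have h2 := h1.congr_of_eventuallyEq (hα.mono fun ε h => h.symm)
    have h3 := h2.unique hD1
    simpa [hy0, hA] using h3
  -- Divide `hβ` by `ε²`: both factors vanish at `0`, with derivatives `A u` and `z`. Together with
  -- `hAz` and symmetry this contradicts `A u u ≠ 0`.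
  have hAuz : A u z = 0 := by
    have h1 := hasDerivAt_iff_tendsto_slope_zero.1 hD1
    have h2 := hasDerivAt_iff_tendsto_slope_zero.1 hyd
    have h3 := (isBoundedBilinearMap_apply.continuous.tendsto (A u, z)).comp (h1.prodMk_nhds h2)
    refine tendsto_nhds_unique h3 (tendsto_const_nhds.congr' ?_)
    filter_upwards [nhdsWithin_le_nhds hβ] with ε hε
    simp [hy0, hcrit, hε]
  exact hu (by rw [← hAz, hsymm z u, hAuz])

/-! ### Second derivatives at critical points and Hessian matrices. -/

section SecondDerivative

variable {V W : Type*} [NormedAddCommGroup V] [NormedSpace ℝ V] [NormedAddCommGroup W]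
  [NormedSpace ℝ W]

/-- The remaining term of the second-order chain rule, `Dh ∘ D²τ`, vanishes at a critical point. -/
theorem fderiv_fderiv_comp_of_fderiv_eq_zero {h : W → ℝ} {τ : V → W} {x : V}
    (hh : ContDiffAt ℝ 2 h (τ x)) (hτ : ContDiffAt ℝ 2 τ x) (hcrit : fderiv ℝ h (τ x) = 0)
    (v w : V) :
    fderiv ℝ (fderiv ℝ (h ∘ τ)) x v w =
      fderiv ℝ (fderiv ℝ h) (τ x) (fderiv ℝ τ x v) (fderiv ℝ τ x w) := by
  have hev : fderiv ℝ (h ∘ τ) =ᶠ[𝓝 x] fun y => (fderiv ℝ h (τ y)).comp (fderiv ℝ τ y) := by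
    have h1 : ∀ᶠ y in 𝓝 x, ContDiffAt ℝ 2 τ y := hτ.eventually (by simp)
    have h2 : ∀ᶠ y in 𝓝 x, ContDiffAt ℝ 2 h (τ y) :=
      hτ.continuousAt.eventually (hh.eventually (by simp))
    filter_upwards [h1, h2] with y hy1 hy2
    exact fderiv_comp y (hy2.differentiableAt (by simp)) (hy1.differentiableAt (by simp))
  have hh' : HasFDerivAt (fderiv ℝ h) (fderiv ℝ (fderiv ℝ h) (τ x)) (τ x) :=
    ((hh.fderiv_right (m := 1) (by norm_num)).differentiableAt (by simp)).hasFDerivAt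
  have hτ' : HasFDerivAt (fderiv ℝ τ) (fderiv ℝ (fderiv ℝ τ) x) x :=
    ((hτ.fderiv_right (m := 1) (by norm_num)).differentiableAt (by simp)).hasFDerivAt
  have hτ1 : HasFDerivAt τ (fderiv ℝ τ x) x := (hτ.differentiableAt (by simp)).hasFDerivAt
  have := (hh'.comp x hτ1).clm_comp hτ'
  rw [hev.fderiv_eq]
  simp only [Function.comp_def] at this
  rw [this.fderiv]
  simp [hcrit]

theorem isUnit_hessian_iff {n : ℕ} (h : Euc n → ℝ) (x : Euc n) :
    IsUnit (hessian h x) ↔ ∀ a, fderiv ℝ (fderiv ℝ h) x a = 0 → a = 0 := by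
  have key : ∀ (v : Fin n → ℝ) (k : Fin n), (hessian h x).vecMul v k =
      fderiv ℝ (fderiv ℝ h) x (WithLp.toLp 2 v) (EuclideanSpace.single k 1) := by
    intro v k
    have hv : WithLp.toLp 2 v = ∑ j, v j • EuclideanSpace.single j (1 : ℝ) := by
      ext i
      simp [Finset.sum_apply, Pi.single_apply]
    rw [hv, map_sum]
    simp [Matrix.vecMul, dotProduct, hessian]
  have ext0 : ∀ L : Euc n →L[ℝ] ℝ, (∀ k, L (EuclideanSpace.single k 1) = 0) → L = 0 := by
    intro L hL
    ext w
    have hw : w = ∑ j, w j • EuclideanSpace.single j (1 : ℝ) := by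
      ext i
      simp [Finset.sum_apply, Pi.single_apply]
    rw [hw, map_sum]
    simp [hL]
  rw [← Matrix.vecMul_injective_iff_isUnit]
  constructor
  · intro hinj a ha
    have : a.ofLp = 0 := by
      apply hinj
      ext k
      simp [key, ha]
    ext i
    simpa using congrFun this i
  · intro hinj v w hvw
    have : WithLp.toLp 2 (v - w) = (0 : Euc n) := by
      apply hinj
      apply ext0
      intro k
      rw [← key, Matrix.sub_vecMul]
      simp only [Pi.sub_apply, sub_eq_zero]
      exact congrFun hvw k
    have h2 : v - w = 0 := congrArg WithLp.ofLp this
    exact sub_eq_zero.1 h2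

end SecondDerivative

theorem hasFDerivAt_norm {d : ℕ} {ξ : Euc d} (hξ : ξ ≠ 0) :
    HasFDerivAt (fun η : Euc d => ‖η‖) (‖ξ‖⁻¹ • innerSL ℝ ξ) ξ := by
  have h0 : ‖ξ‖ ≠ 0 := norm_ne_zero_iff.2 hξ
  have h1 := ((hasFDerivAt_id ξ).norm_sq).sqrt (by simpa using hξ)
  simp only [id, Real.sqrt_sq (norm_nonneg _)] at h1
  convert! h1 using 1
  ext z
  simp
  field_simp

theorem hasFDerivAt_normalize {d : ℕ} {ξ : Euc d} (hξ : ξ ≠ 0) :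
    HasFDerivAt (fun η : Euc d => ‖η‖⁻¹ • η)
      (‖ξ‖⁻¹ • ContinuousLinearMap.id ℝ (Euc d) -
        (‖ξ‖⁻¹ ^ 3 • innerSL ℝ ξ).smulRight ξ) ξ := by
  have h0 : ‖ξ‖ ≠ 0 := norm_ne_zero_iff.2 hξ
  have h1 := ((hasDerivAt_inv h0).comp_hasFDerivAt ξ (hasFDerivAt_norm hξ)).smul (hasFDerivAt_id ξ)
  convert! h1 using 1
  ext z i
  simp
  field_simp
  ring

theorem contDiffAt_normalize {d : ℕ} {ξ : Euc d} (hξ : ξ ≠ 0) :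
    ContDiffAt ℝ ∞ (fun η : Euc d => ‖η‖⁻¹ • η) ξ :=
  ((contDiffAt_norm ℝ hξ).inv (norm_ne_zero_iff.2 hξ)).smul contDiffAt_id

/-! ### Morse functions on the sphere through their homogeneous extensions. -/

section Sphere

variable {n : ℕ}

theorem norm_coe_sphere (p : Sph n) : ‖(p : Euc (n + 1))‖ = 1 := by
  simp

theorem coe_sphere_ne_zero (p : Sph n) : (p : Euc (n + 1)) ≠ 0 := fun h => by
  have := norm_coe_sphere p
  simp [h] at this

instance : Nonempty (Sph n) :=
  ⟨⟨EuclideanSpace.single 0 1, by simp⟩⟩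

/-- The radial projection onto the sphere. -/
def radial (ξ : Euc (n + 1)) : Sph n :=
  open Classical in
  if h : ξ ≠ 0 then ⟨‖ξ‖⁻¹ • ξ, by simp [norm_smul, norm_ne_zero_iff.mpr h]⟩
  else Classical.arbitrary _

theorem coe_radial {ξ : Euc (n + 1)} (hξ : ξ ≠ 0) : (radial ξ : Euc (n + 1)) = ‖ξ‖⁻¹ • ξ := by
  simp [radial, hξ]

theorem radial_coe (p : Sph n) : radial (p : Euc (n + 1)) = p := by
  ext1
  rw [coe_radial (coe_sphere_ne_zero p), norm_coe_sphere, inv_one, one_smul]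

theorem homogeneousExtension_eq (φ : Sph n → ℝ) {ξ : Euc (n + 1)} (hξ : ξ ≠ 0) :
    homogeneousExtension φ ξ = φ (radial ξ) := by
  simp [homogeneousExtension, radial, hξ]

theorem homogeneousExtension_coe (φ : Sph n → ℝ) (p : Sph n) :
    homogeneousExtension φ (p : Euc (n + 1)) = φ p := by
  rw [homogeneousExtension_eq φ (coe_sphere_ne_zero p), radial_coe]

theorem contMDiffAt_radial {ξ : Euc (n + 1)} (hξ : ξ ≠ 0) :
    ContMDiffAt 𝓘(ℝ, Euc (n + 1)) (𝓡 n) ∞ (radial (n := n)) ξ := by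
  have := Fact.mk (@finrank_euclideanSpace_fin ℝ _ (n + 1))
  let U : TopologicalSpace.Opens (Euc (n + 1)) := ⟨{0}ᶜ, isOpen_compl_singleton⟩
  have h1 : ContMDiff 𝓘(ℝ, Euc (n + 1)) 𝓘(ℝ, Euc (n + 1)) ∞
      (fun x : U => ‖(x : Euc (n + 1))‖⁻¹ • (x : Euc (n + 1))) := fun x =>
    (contMDiffAt_subtype_iff (f := fun η : Euc (n + 1) => ‖η‖⁻¹ • η)).2
      (contDiffAt_normalize x.2).contMDiffAt
  have h2 := h1.codRestrict_sphere (n := n) (fun x => by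
    have : ‖(x : Euc (n + 1))‖ ≠ 0 := norm_ne_zero_iff.2 x.2
    simp [norm_smul, this])
  have h3 := h2 ⟨ξ, hξ⟩
  refine (contMDiffAt_subtype_iff (U := U) (f := radial (n := n)) (x := ⟨ξ, hξ⟩)).1 ?_
  convert! h3 using 1
  ext1 x
  ext1
  exact coe_radial x.2

theorem isSmoothZeroHomogeneous_homogeneousExtension (φ : C^∞⟮𝓡 n, Sph n; ℝ⟯) :
    IsSmoothZeroHomogeneous (homogeneousExtension φ) where
  smooth := fun ξ hξ => by
    have h1 : ContMDiffAt 𝓘(ℝ, Euc (n + 1)) 𝓘(ℝ, ℝ) ∞ (φ ∘ radial (n := n)) ξ :=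
      (φ.contMDiff (radial ξ)).comp ξ (contMDiffAt_radial hξ)
    have h2 : homogeneousExtension φ =ᶠ[𝓝 ξ] φ ∘ radial (n := n) := by
      filter_upwards [isOpen_compl_singleton.mem_nhds hξ] with η hη
      exact homogeneousExtension_eq φ hη
    exact (h1.contDiffAt.congr_of_eventuallyEq h2).contDiffWithinAt
  homogeneous := fun r hr ξ hξ => by
    have hrξ : r • ξ ≠ 0 := smul_ne_zero hr.ne' hξ
    rw [homogeneousExtension_eq φ hrξ, homogeneousExtension_eq φ hξ]
    congr 1
    ext1
    rw [coe_radial hrξ, coe_radial hξ, norm_smul, Real.norm_of_nonneg hr.le, smul_smul]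
    congr 1
    field_simp

variable {ψ : OpenPartialHomeomorph (Sph n) (Euc n)}

theorem contDiffAt_coe_symm (hψ : ψ ∈ IsManifold.maximalAtlas (𝓡 n) ∞ (Sph n)) {y : Euc n}
    (hy : y ∈ ψ.target) :
    ContDiffAt ℝ ∞ (fun y => (ψ.symm y : Euc (n + 1))) y := by
  have := Fact.mk (@finrank_euclideanSpace_fin ℝ _ (n + 1))
  have h1 : ContMDiffAt (𝓡 n) (𝓡 n) ∞ ψ.symm y :=
    (contMDiffOn_symm_of_mem_maximalAtlas hψ).contMDiffAt (ψ.open_target.mem_nhds hy)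
  have h2 : ContMDiffAt (𝓡 n) 𝓘(ℝ, Euc (n + 1)) ∞ ((↑) : Sph n → Euc (n + 1)) (ψ.symm y) :=
    contMDiff_coe_sphere _
  exact (h2.comp y h1).contDiffAt

theorem contDiffAt_comp_radial (hψ : ψ ∈ IsManifold.maximalAtlas (𝓡 n) ∞ (Sph n)) {p : Sph n}
    (hp : p ∈ ψ.source) : ContDiffAt ℝ ∞ (fun ξ => ψ (radial ξ)) (p : Euc (n + 1)) := by
  have h1 : ContMDiffAt (𝓡 n) (𝓡 n) ∞ ψ (radial (p : Euc (n + 1))) := by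
    rw [radial_coe]
    exact (contMDiffOn_of_mem_maximalAtlas hψ).contMDiffAt (ψ.open_source.mem_nhds hp)
  exact (h1.comp _ (contMDiffAt_radial (coe_sphere_ne_zero p))).contDiffAt

theorem eventually_radial_mem_source {p : Sph n} (hp : p ∈ ψ.source) :
    ∀ᶠ ξ in 𝓝 (p : Euc (n + 1)), radial ξ ∈ ψ.source :=
  (contMDiffAt_radial (coe_sphere_ne_zero p)).continuousAt.eventually
    (by rw [radial_coe]; exact ψ.open_source.mem_nhds hp)

theorem comp_symm_eq_homogeneousExtension_comp (φ : Sph n → ℝ) :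
    φ ∘ ψ.symm = homogeneousExtension φ ∘ fun y => (ψ.symm y : Euc (n + 1)) :=
  funext fun y => (homogeneousExtension_coe φ (ψ.symm y)).symm

theorem contDiffAt_comp_symm (hψ : ψ ∈ IsManifold.maximalAtlas (𝓡 n) ∞ (Sph n))
    (φ : C^∞⟮𝓡 n, Sph n; ℝ⟯) {y : Euc n} (hy : y ∈ ψ.target) :
    ContDiffAt ℝ ∞ (φ ∘ ψ.symm) y := by
  rw [comp_symm_eq_homogeneousExtension_comp]
  exact ((isSmoothZeroHomogeneous_homogeneousExtension φ).contDiffAt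
    (coe_sphere_ne_zero _)).comp y (contDiffAt_coe_symm hψ hy)

theorem homogeneousExtension_eventuallyEq (φ : Sph n → ℝ) {p : Sph n} (hp : p ∈ ψ.source) :
    homogeneousExtension φ =ᶠ[𝓝 (p : Euc (n + 1))] (φ ∘ ψ.symm) ∘ fun ξ => ψ (radial ξ) := by
  filter_upwards [eventually_radial_mem_source hp,
    isOpen_compl_singleton.mem_nhds (coe_sphere_ne_zero p)] with ξ hξ hξ0
  rw [homogeneousExtension_eq φ hξ0]
  simp [ψ.left_inv hξ]

theorem fderiv_comp_radial_fderiv_coe_symm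
    (hψ : ψ ∈ IsManifold.maximalAtlas (𝓡 n) ∞ (Sph n)) {p : Sph n} (hp : p ∈ ψ.source) (a : Euc n) :
    fderiv ℝ (fun ξ => ψ (radial ξ)) (p : Euc (n + 1))
      (fderiv ℝ (fun y => (ψ.symm y : Euc (n + 1))) (ψ p) a) = a := by
  have hτ : HasFDerivAt (fun ξ => ψ (radial ξ))
      (fderiv ℝ (fun ξ => ψ (radial ξ)) (p : Euc (n + 1))) (ψ.symm (ψ p) : Euc (n + 1)) := by
    rw [ψ.left_inv hp]
    exact ((contDiffAt_comp_radial hψ hp).differentiableAt (by simp)).hasFDerivAt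
  have hσ := ((contDiffAt_coe_symm hψ (ψ.map_source hp)).differentiableAt (by simp)).hasFDerivAt
  have h1 := hτ.comp (ψ p) hσ
  have h2 : HasFDerivAt ((fun ξ => ψ (radial ξ)) ∘ fun y => (ψ.symm y : Euc (n + 1)))
      (ContinuousLinearMap.id ℝ (Euc n)) (ψ p) := by
    refine (hasFDerivAt_id (ψ p)).congr_of_eventuallyEq ?_
    filter_upwards [ψ.open_target.mem_nhds (ψ.map_source hp)] with y hy
    simp [radial_coe, ψ.right_inv hy]
  exact congrArg (fun L => L a) (h1.unique h2)

/-- The composition is `ξ ↦ ξ / ‖ξ‖`, whose derivative at `p` is the orthogonal projection onto the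
tangent space `p^⊥`. With the preceding lemma, the derivatives of `ψ⁻¹` and `ψ ∘ radial` are
mutually inverse between `ℝ^n` and `p^⊥`. -/
theorem fderiv_coe_symm_fderiv_comp_radial
    (hψ : ψ ∈ IsManifold.maximalAtlas (𝓡 n) ∞ (Sph n)) {p : Sph n} (hp : p ∈ ψ.source)
    {z : Euc (n + 1)} (hz : inner ℝ (p : Euc (n + 1)) z = 0) :
    fderiv ℝ (fun y => (ψ.symm y : Euc (n + 1))) (ψ p)
      (fderiv ℝ (fun ξ => ψ (radial ξ)) (p : Euc (n + 1)) z) = z := by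
  have hτ := ((contDiffAt_comp_radial hψ hp).differentiableAt (by simp)).hasFDerivAt
  have hσ : HasFDerivAt (fun y => (ψ.symm y : Euc (n + 1)))
      (fderiv ℝ (fun y => (ψ.symm y : Euc (n + 1))) (ψ p)) (ψ (radial (p : Euc (n + 1)))) := by
    rw [radial_coe]
    exact ((contDiffAt_coe_symm hψ (ψ.map_source hp)).differentiableAt (by simp)).hasFDerivAt
  have h1 := hσ.comp (p : Euc (n + 1)) hτ
  have h2 := (hasFDerivAt_normalize (coe_sphere_ne_zero p)).congr_of_eventuallyEq
    (f₁ := (fun y => (ψ.symm y : Euc (n + 1))) ∘ fun ξ => ψ (radial ξ)) (by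
      filter_upwards [eventually_radial_mem_source hp,
        isOpen_compl_singleton.mem_nhds (coe_sphere_ne_zero p)] with ξ hξ hξ0
      simp [ψ.left_inv hξ, coe_radial hξ0])
  have h3 := congrArg (fun L => L z) (h1.unique h2)
  simpa [hz] using h3

/-- Each function factors through the other, by `ψ⁻¹` in one direction and by `ψ ∘ radial` near `p`
in the other; both implications are the chain rule. -/
theorem fderiv_comp_symm_eq_zero_iff (hψ : ψ ∈ IsManifold.maximalAtlas (𝓡 n) ∞ (Sph n))
    (φ : C^∞⟮𝓡 n, Sph n; ℝ⟯) {p : Sph n} (hp : p ∈ ψ.source) :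
    fderiv ℝ (φ ∘ ψ.symm) (ψ p) = 0 ↔
      fderiv ℝ (homogeneousExtension φ) (p : Euc (n + 1)) = 0 := by
  constructor
  · intro h
    rw [(homogeneousExtension_eventuallyEq φ hp).fderiv_eq, fderiv_comp, radial_coe, h]
    · simp
    · rw [radial_coe]
      exact (contDiffAt_comp_symm hψ φ (ψ.map_source hp)).differentiableAt (by simp)
    · exact (contDiffAt_comp_radial hψ hp).differentiableAt (by simp)
  · intro h
    rw [comp_symm_eq_homogeneousExtension_comp, fderiv_comp, ψ.left_inv hp, h]
    · simp
    · exact ((isSmoothZeroHomogeneous_homogeneousExtension φ).contDiffAt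
        (coe_sphere_ne_zero _)).differentiableAt (by simp)
    · exact (contDiffAt_coe_symm hψ (ψ.map_source hp)).differentiableAt (by simp)

/-- At a critical point the Hessian of the extension is the pullback of the chart Hessian by the
derivative of `ψ ∘ radial`, which restricts to an isomorphism from `p^⊥` onto `ℝ^n`. -/
theorem isUnit_hessian_comp_symm_iff (hψ : ψ ∈ IsManifold.maximalAtlas (𝓡 n) ∞ (Sph n))
    (φ : C^∞⟮𝓡 n, Sph n; ℝ⟯) {p : Sph n} (hp : p ∈ ψ.source)
    (hcrit : fderiv ℝ (homogeneousExtension φ) (p : Euc (n + 1)) = 0) :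
    IsUnit (hessian (φ ∘ ψ.symm) (ψ p)) ↔ ∀ z, inner ℝ (p : Euc (n + 1)) z = 0 →
      fderiv ℝ (fderiv ℝ (homogeneousExtension φ)) (p : Euc (n + 1)) z = 0 → z = 0 := by
  have h2top : (2 : WithTop ℕ∞) ≤ ((⊤ : ℕ∞) : WithTop ℕ∞) := WithTop.coe_le_coe.2 le_top
  have hF := isSmoothZeroHomogeneous_homogeneousExtension φ
  have hp0 := coe_sphere_ne_zero p
  have hcrit' := (fderiv_comp_symm_eq_zero_iff hψ φ hp).2 hcrit
  have hD2 : ∀ z w, fderiv ℝ (fderiv ℝ (homogeneousExtension φ)) (p : Euc (n + 1)) z w =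
      fderiv ℝ (fderiv ℝ (φ ∘ ψ.symm)) (ψ p)
        (fderiv ℝ (fun ξ => ψ (radial ξ)) (p : Euc (n + 1)) z)
        (fderiv ℝ (fun ξ => ψ (radial ξ)) (p : Euc (n + 1)) w) := by
    intro z w
    rw [(homogeneousExtension_eventuallyEq φ hp).fderiv.fderiv_eq,
      fderiv_fderiv_comp_of_fderiv_eq_zero, radial_coe]
    · rw [radial_coe]
      exact (contDiffAt_comp_symm hψ φ (ψ.map_source hp)).of_le h2top
    · exact (contDiffAt_comp_radial hψ hp).of_le h2top
    · rw [radial_coe]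
      exact hcrit'
  rw [isUnit_hessian_iff]
  constructor
  · intro hreg z hz hDz
    have h1 : fderiv ℝ (fun ξ => ψ (radial ξ)) (p : Euc (n + 1)) z = 0 := by
      apply hreg
      ext b
      have := hD2 z (fderiv ℝ (fun y => (ψ.symm y : Euc (n + 1))) (ψ p) b)
      rw [fderiv_comp_radial_fderiv_coe_symm hψ hp, hDz] at this
      rw [← this]
      rfl
    rw [← fderiv_coe_symm_fderiv_comp_radial hψ hp hz, h1, map_zero]
  · intro hreg a ha
    set z := fderiv ℝ (fun y => (ψ.symm y : Euc (n + 1))) (ψ p) a with hz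
    have hza : fderiv ℝ (fun ξ => ψ (radial ξ)) (p : Euc (n + 1)) z = a :=
      fderiv_comp_radial_fderiv_coe_symm hψ hp a
    -- Differentiate `‖ψ⁻¹ y‖² = 1`.
    have hperp : inner ℝ (p : Euc (n + 1)) z = 0 := by
      have hσ := ((contDiffAt_coe_symm hψ (ψ.map_source hp)).differentiableAt
        (by simp)).hasFDerivAt
      have h1 := hσ.norm_sq
      have h2 : HasFDerivAt (fun y => ‖(ψ.symm y : Euc (n + 1))‖ ^ 2) (0 : Euc n →L[ℝ] ℝ)
          (ψ p) := by
        simpa using hasFDerivAt_const (1 : ℝ) (ψ p)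
      have h3 := congrArg (fun L => L a) (h1.unique h2)
      simpa [ψ.left_inv hp, ← hz] using h3
    have hz0 : z = 0 := by
      refine hreg z hperp ?_
      ext w
      rw [hD2, hza, ha]
      rfl
    rw [← hza, hz0, map_zero]

theorem mfderiv_eq_zero_iff (φ : C^∞⟮𝓡 n, Sph n; ℝ⟯) (p : Sph n) :
    mfderiv (𝓡 n) 𝓘(ℝ, ℝ) φ p = 0 ↔
      fderiv ℝ (homogeneousExtension φ) (p : Euc (n + 1)) = 0 := by
  rw [← fderiv_comp_symm_eq_zero_iff (IsManifold.chart_mem_maximalAtlas p) φ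
    (mem_chart_source (Euc n) p), (φ.contMDiff.mdifferentiableAt (by simp)).mfderiv]
  simp [writtenInExtChartAt, extChartAt, fderivWithin_univ]
  rfl

/-- Extrinsic description of Morse functions on the sphere. -/
theorem isMorse_iff (φ : C^∞⟮𝓡 n, Sph n; ℝ⟯) :
    IsMorse φ ↔ ∀ p : Sph n, fderiv ℝ (homogeneousExtension φ) (p : Euc (n + 1)) = 0 →
      ∀ z, inner ℝ (p : Euc (n + 1)) z = 0 →
        fderiv ℝ (fderiv ℝ (homogeneousExtension φ)) (p : Euc (n + 1)) z = 0 → z = 0 := by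
  refine forall_congr' fun p => ?_
  rw [mfderiv_eq_zero_iff]
  refine imp_congr_right fun hcrit => ?_
  constructor
  · rintro ⟨ψ, hψ, hp, -, hu⟩
    exact (isUnit_hessian_comp_symm_iff hψ φ hp hcrit).1 hu
  · intro h
    have hψ := IsManifold.chart_mem_maximalAtlas (I := 𝓡 n) (n := ∞) p
    have hp := mem_chart_source (Euc n) p
    exact ⟨_, hψ, hp, (fderiv_comp_symm_eq_zero_iff hψ φ hp).2 hcrit,
      (isUnit_hessian_comp_symm_iff hψ φ hp hcrit).2 h⟩

end Sphere

/-! ### Openness of the Morse condition. -/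

section Open

variable {n : ℕ}

/-- The `2`-jets which are not degenerate critical jets. -/
def nondegenerateJets (n : ℕ) :
    Set (ContinuousMultilinearMap ℝ (fun _ : Fin 1 => Euc n) ℝ ×
      ContinuousMultilinearMap ℝ (fun _ : Fin 2 => Euc n) ℝ) :=
  {j | j.1 ≠ 0 ∨ (Matrix.of fun a b : Fin n =>
    j.2 ![EuclideanSpace.single a 1, EuclideanSpace.single b 1]).det ≠ 0}

theorem isOpen_nondegenerateJets (n : ℕ) : IsOpen (nondegenerateJets n) := by
  refine IsOpen.union (isOpen_ne.preimage continuous_fst) (isOpen_ne.preimage ?_)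
  refine Continuous.matrix_det ?_
  refine continuous_matrix fun a b => ?_
  exact (ContinuousMultilinearMap.apply ℝ (fun _ : Fin 2 => Euc n) ℝ
    ![EuclideanSpace.single a 1, EuclideanSpace.single b 1]).continuous.comp continuous_snd

theorem jet_mem_nondegenerateJets_iff (h : Euc n → ℝ) (y : Euc n) :
    (iteratedFDeriv ℝ 1 h y, iteratedFDeriv ℝ 2 h y) ∈ nondegenerateJets n ↔
      (fderiv ℝ h y = 0 → IsUnit (hessian h y)) := by
  have h1 : iteratedFDeriv ℝ 1 h y = 0 ↔ fderiv ℝ h y = 0 := by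
    rw [← norm_eq_zero, norm_iteratedFDeriv_one, norm_eq_zero]
  have h2 : (Matrix.of fun a b : Fin n => iteratedFDeriv ℝ 2 h y
      ![EuclideanSpace.single a 1, EuclideanSpace.single b 1]) = hessian h y := by
    ext a b
    simp [hessian, iteratedFDeriv_two_apply]
  rw [nondegenerateJets, mem_ofPred_eq, h2, Matrix.isUnit_iff_isUnit_det, isUnit_iff_ne_zero, ne_eq,
    h1, or_iff_not_imp_left, not_not]

variable {ψ : OpenPartialHomeomorph (Sph n) (Euc n)}

theorem continuousAt_iteratedFDeriv_comp_symm
    (hψ : ψ ∈ IsManifold.maximalAtlas (𝓡 n) ∞ (Sph n))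
    (φ : C^∞⟮𝓡 n, Sph n; ℝ⟯) (k : ℕ) {x : Sph n} (hx : x ∈ ψ.source) :
    ContinuousAt (fun x => iteratedFDeriv ℝ k (φ ∘ ψ.symm) (ψ x)) x := by
  have h1 : ContDiffAt ℝ 0 (iteratedFDeriv ℝ k (φ ∘ ψ.symm)) (ψ x) :=
    (contDiffAt_comp_symm hψ φ (ψ.map_source hx)).iteratedFDeriv_right
      (by rw [zero_add]; exact WithTop.coe_le_coe.2 le_top)
  exact h1.continuousAt.comp (ψ.continuousAt hx)

theorem jet_mem_nondegenerateJets_of_isMorse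
    (hψ : ψ ∈ IsManifold.maximalAtlas (𝓡 n) ∞ (Sph n)) {φ : C^∞⟮𝓡 n, Sph n; ℝ⟯}
    (hφ : IsMorse φ) {x : Sph n} (hx : x ∈ ψ.source) :
    (iteratedFDeriv ℝ 1 (φ ∘ ψ.symm) (ψ x), iteratedFDeriv ℝ 2 (φ ∘ ψ.symm) (ψ x)) ∈
      nondegenerateJets n := by
  rw [jet_mem_nondegenerateJets_iff]
  intro h
  have hc := (fderiv_comp_symm_eq_zero_iff hψ φ hx).1 h
  exact (isUnit_hessian_comp_symm_iff hψ φ hx hc).2 ((isMorse_iff φ).1 hφ x hc)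

theorem isMorse_of_forall_jet_mem {φ : C^∞⟮𝓡 n, Sph n; ℝ⟯}
    (h : ∀ x : Sph n, ∃ ψ ∈ IsManifold.maximalAtlas (𝓡 n) ∞ (Sph n), x ∈ ψ.source ∧
      (iteratedFDeriv ℝ 1 (φ ∘ ψ.symm) (ψ x), iteratedFDeriv ℝ 2 (φ ∘ ψ.symm) (ψ x)) ∈
        nondegenerateJets n) : IsMorse φ := by
  rw [isMorse_iff]
  intro x hc
  obtain ⟨ψ, hψ, hx, hj⟩ := h x
  rw [jet_mem_nondegenerateJets_iff] at hj
  exact (isUnit_hessian_comp_symm_iff hψ φ hx hc).1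
    (hj ((fderiv_comp_symm_eq_zero_iff hψ φ hx).2 hc))

theorem exists_tolerance (hψ : ψ ∈ IsManifold.maximalAtlas (𝓡 n) ∞ (Sph n))
    {φ : C^∞⟮𝓡 n, Sph n; ℝ⟯} (hφ : IsMorse φ) {K : Set (Sph n)} (hK : IsCompact K)
    (hKψ : K ⊆ ψ.source) :
    ∃ ε > 0, ∀ g : C^∞⟮𝓡 n, Sph n; ℝ⟯, (∀ x ∈ K, ∀ k ≤ 2,
      ‖iteratedFDeriv ℝ k (g ∘ ψ.symm) (ψ x) - iteratedFDeriv ℝ k (φ ∘ ψ.symm) (ψ x)‖ < ε) →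
      ∀ x ∈ K, (iteratedFDeriv ℝ 1 (g ∘ ψ.symm) (ψ x), iteratedFDeriv ℝ 2 (g ∘ ψ.symm) (ψ x)) ∈
        nondegenerateJets n := by
  have hcont : ContinuousOn (fun x => (iteratedFDeriv ℝ 1 (φ ∘ ψ.symm) (ψ x),
      iteratedFDeriv ℝ 2 (φ ∘ ψ.symm) (ψ x))) K := fun x hx =>
    ((continuousAt_iteratedFDeriv_comp_symm hψ φ 1 (hKψ hx)).prodMk
      (continuousAt_iteratedFDeriv_comp_symm hψ φ 2 (hKψ hx))).continuousWithinAt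
  obtain ⟨ε, hε, hsub⟩ := (hK.image_of_continuousOn hcont).exists_thickening_subset_open
    (isOpen_nondegenerateJets n) (by
      rintro _ ⟨x, hx, rfl⟩
      exact jet_mem_nondegenerateJets_of_isMorse hψ hφ (hKψ hx))
  refine ⟨ε, hε, fun g hg x hx => hsub ?_⟩
  rw [Metric.mem_thickening_iff]
  refine ⟨_, mem_image_of_mem _ hx, ?_⟩
  rw [Prod.dist_eq, dist_eq_norm, dist_eq_norm]
  exact max_lt (hg x hx 1 (by norm_num)) (hg x hx 2 le_rfl)

/-- Finitely many compact sets inside chart domains cover the sphere. On each, the 2-jets of a Morse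
function form a compact subset of the open set `nondegenerateJets`, which leaves a uniform
tolerance. -/
theorem isOpen_isMorse (n : ℕ) :
    IsOpen[whitneyTopology n (Sph n)] {φ : C^∞⟮𝓡 n, Sph n; ℝ⟯ | IsMorse φ} := by
  let _ := whitneyTopology n (Sph n)
  rw [isOpen_iff_forall_mem_open]
  intro φ hφ
  have hK : ∀ p : Sph n, ∃ K : Set (Sph n), IsCompact K ∧ p ∈ interior K ∧
      K ⊆ (chartAt (Euc n) p).source := fun p =>
    exists_compact_subset (chartAt (Euc n) p).open_source (mem_chart_source (Euc n) p)
  choose K hKc hKp hKs using hK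
  have hψ := fun p : Sph n => IsManifold.chart_mem_maximalAtlas (I := 𝓡 n) (n := ∞) p
  choose ε hε hεg using fun p => exists_tolerance (hψ p) hφ (hKc p) (hKs p)
  obtain ⟨t, ht⟩ := CompactSpace.elim_nhds_subcover K fun p => mem_interior_iff_mem_nhds.1 (hKp p)
  refine ⟨strongNhd φ 2 (fun i : t => chartAt (Euc n) (i : Sph n)) (fun i => K i) (fun i => ε i),
    fun g hg => ?_, ?_, ?_⟩
  · refine isMorse_of_forall_jet_mem fun x => ?_
    obtain ⟨p, hp, hx⟩ := mem_iUnion₂.1 (ht.symm ▸ mem_univ x : x ∈ ⋃ p ∈ t, K p)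
    exact ⟨_, hψ p, hKs p hx, hεg p g (fun y hy => hg ⟨p, hp⟩ y hy) x hx⟩
  · exact TopologicalSpace.isOpen_generateFrom_of_mem ⟨φ, 2, t, _, _, _, fun i => hψ i,
      locallyFinite_of_finite _, fun i => ⟨hKc i, hKs i⟩, fun i => hε i, rfl⟩
  · intro i x _ k _
    simpa using hε i

end Open

/-! ### Linear perturbations in the Whitney topology. -/

section Dense

variable {n : ℕ}

/-- The perturbation of `φ` by the linear function `⟨a, ·⟩`. -/
def linearPerturbation (φ : C^∞⟮𝓡 n, Sph n; ℝ⟯) (a : Euc (n + 1)) : C^∞⟮𝓡 n, Sph n; ℝ⟯ :=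
  ⟨fun x => φ x + innerSL ℝ a (x : Euc (n + 1)), by
    have := Fact.mk (@finrank_euclideanSpace_fin ℝ _ (n + 1))
    exact φ.contMDiff.add ((innerSL ℝ a).contMDiff.comp contMDiff_coe_sphere)⟩

/-- In a chart the derivatives of the perturbed function are affine in `a`, so the strict
inequalities persist for small `a`, uniformly on each compact `K i`. The centre `f` may differ from
`φ` because these sets only generate the topology. -/
theorem eventually_linearPerturbation_mem_strongNhd {φ f : C^∞⟮𝓡 n, Sph n; ℝ⟯} {r : ℕ} {ι : Type}
    {ψ : ι → OpenPartialHomeomorph (Sph n) (Euc n)} {K : ι → Set (Sph n)} {ε : ι → ℝ}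
    (hψ : ∀ i, ψ i ∈ IsManifold.maximalAtlas (𝓡 n) ∞ (Sph n))
    (hfin : LocallyFinite fun i => (ψ i).source)
    (hK : ∀ i, IsCompact (K i) ∧ K i ⊆ (ψ i).source) (hφ : φ ∈ strongNhd f r ψ K ε) :
    ∀ᶠ a in 𝓝 0, linearPerturbation φ a ∈ strongNhd f r ψ K ε := by
  -- By compactness of the sphere; the remaining charts are empty and impose no condition.
  have hI : {i | (ψ i).source.Nonempty}.Finite := hfin.finite_nonempty_of_compact
  have key : ∀ i, ∀ k ≤ r, ∀ᶠ a in 𝓝 (0 : Euc (n + 1)), ∀ x ∈ K i,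
      ‖iteratedFDeriv ℝ k (linearPerturbation φ a ∘ (ψ i).symm) (ψ i x) -
        iteratedFDeriv ℝ k (f ∘ (ψ i).symm) (ψ i x)‖ < ε i := by
    intro i k hk
    refine (hK i).1.eventually_forall_of_forall_eventually fun x hx => ?_
    have hxs := (hK i).2 hx
    have hktop : (k : WithTop ℕ∞) ≤ ((⊤ : ℕ∞) : WithTop ℕ∞) := WithTop.coe_le_coe.2 le_top
    set σ : Euc n → Euc (n + 1) := fun y => ((ψ i).symm y : Euc (n + 1)) with hσ
    have hformula : ∀ (a : Euc (n + 1)), ∀ x' ∈ (ψ i).source,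
        iteratedFDeriv ℝ k (linearPerturbation φ a ∘ (ψ i).symm) (ψ i x') =
          iteratedFDeriv ℝ k (φ ∘ (ψ i).symm) (ψ i x') +
          ContinuousLinearMap.compContinuousMultilinearMapL ℝ (fun _ : Fin k => Euc n)
            (Euc (n + 1)) ℝ (innerSL ℝ a) (iteratedFDeriv ℝ k σ (ψ i x')) := by
      intro a x' hx'
      have hy := (ψ i).map_source hx'
      have h1 : ContDiffAt ℝ k (φ ∘ (ψ i).symm) (ψ i x') :=
        (contDiffAt_comp_symm (hψ i) φ hy).of_le hktop
      have h2 : ContDiffAt ℝ k σ (ψ i x') := (contDiffAt_coe_symm (hψ i) hy).of_le hktop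
      have h3 : ContDiffAt ℝ k (innerSL ℝ a ∘ σ) (ψ i x') :=
        (innerSL ℝ a).contDiff.contDiffAt.comp _ h2
      have h4 := (innerSL ℝ a).iteratedFDeriv_comp_left h2 le_rfl
      rw [ContinuousLinearMap.compContinuousMultilinearMapL_apply, ← h4,
        ← iteratedFDeriv_add_apply h1 h3]
      rfl
    have hσc : ContinuousAt (fun x' => iteratedFDeriv ℝ k σ (ψ i x')) x := by
      have h1 : ContDiffAt ℝ 0 (iteratedFDeriv ℝ k σ) (ψ i x) :=
        (contDiffAt_coe_symm (hψ i) ((ψ i).map_source hxs)).iteratedFDeriv_right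
          (by rw [zero_add]; exact hktop)
      exact h1.continuousAt.comp ((ψ i).continuousAt hxs)
    have hc : ContinuousAt (fun z : Euc (n + 1) × Sph n =>
        ‖iteratedFDeriv ℝ k (φ ∘ (ψ i).symm) (ψ i z.2) +
          ContinuousLinearMap.compContinuousMultilinearMapL ℝ (fun _ : Fin k => Euc n)
            (Euc (n + 1)) ℝ (innerSL ℝ z.1) (iteratedFDeriv ℝ k σ (ψ i z.2)) -
          iteratedFDeriv ℝ k (f ∘ (ψ i).symm) (ψ i z.2)‖) (0, x) := by
      have hs : ContinuousAt (Prod.snd : Euc (n + 1) × Sph n → Sph n) (0, x) := continuousAt_snd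
      refine (((ContinuousAt.comp (x := ((0 : Euc (n + 1)), x)) (f := Prod.snd)
        (continuousAt_iteratedFDeriv_comp_symm (hψ i) φ k hxs) hs).add (ContinuousAt.clm_apply ?_
        (ContinuousAt.comp (x := ((0 : Euc (n + 1)), x)) (f := Prod.snd) hσc hs))).sub
        (ContinuousAt.comp (x := ((0 : Euc (n + 1)), x)) (f := Prod.snd)
          (continuousAt_iteratedFDeriv_comp_symm (hψ i) f k hxs) hs)).norm
      exact ((ContinuousLinearMap.compContinuousMultilinearMapL ℝ (fun _ : Fin k => Euc n)
        (Euc (n + 1)) ℝ).continuous.comp ((innerSL ℝ).continuous.comp continuous_fst)).continuousAt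
    have hlt := hφ i x hx k hk
    have hsrc : ∀ᶠ z : Euc (n + 1) × Sph n in 𝓝 (0, x), z.2 ∈ (ψ i).source :=
      continuousAt_snd.eventually ((ψ i).open_source.mem_nhds hxs)
    filter_upwards [hc.eventually (gt_mem_nhds (by simpa using hlt)), hsrc] with z hz hzs
    rw [hformula z.1 z.2 hzs]
    exact hz
  have key2 : ∀ᶠ a in 𝓝 (0 : Euc (n + 1)), ∀ i ∈ {i | (ψ i).source.Nonempty}, ∀ k ∈ Iic r,
      ∀ x ∈ K i, ‖iteratedFDeriv ℝ k (linearPerturbation φ a ∘ (ψ i).symm) (ψ i x) -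
        iteratedFDeriv ℝ k (f ∘ (ψ i).symm) (ψ i x)‖ < ε i :=
    (eventually_all_finite hI).2 fun i _ =>
      (eventually_all_finite (finite_Iic r)).2 fun k hk => key i k hk
  filter_upwards [key2] with a ha i x hx k hk
  exact ha i ⟨x, (hK i).2 hx⟩ k hk x hx

theorem tendsto_linearPerturbation (φ : C^∞⟮𝓡 n, Sph n; ℝ⟯) :
    Tendsto (linearPerturbation φ) (𝓝 0) (@nhds _ (whitneyTopology n (Sph n)) φ) := by
  rw [TopologicalSpace.tendsto_nhds_generateFrom_iff]
  rintro _ ⟨f, r, ι, ψ, K, ε, hψ, hfin, hK, -, rfl⟩ hφ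
  exact eventually_linearPerturbation_mem_strongNhd hψ hfin hK hφ

end Dense

/-! ### Density of Morse functions by Sard's theorem. -/

theorem IsSmoothZeroHomogeneous.fderiv_smul {d : ℕ} {Φ : Euc d → ℝ}
    (hΦ : IsSmoothZeroHomogeneous Φ) {r : ℝ} (hr : 0 < r) {ξ : Euc d} (hξ : ξ ≠ 0) :
    r • fderiv ℝ Φ (r • ξ) = fderiv ℝ Φ ξ := by
  have h1 : HasFDerivAt (fun η : Euc d => r • η) (r • ContinuousLinearMap.id ℝ (Euc d)) ξ :=
    (hasFDerivAt_id ξ).const_smul r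
  have h2 := ((hΦ.contDiffAt (smul_ne_zero hr.ne' hξ)).differentiableAt
    (by simp)).hasFDerivAt.comp ξ h1
  have h3 : HasFDerivAt (Φ ∘ fun η : Euc d => r • η) (fderiv ℝ Φ ξ) ξ := by
    refine ((hΦ.contDiffAt hξ).differentiableAt (by simp)).hasFDerivAt.congr_of_eventuallyEq ?_
    filter_upwards [isOpen_compl_singleton.mem_nhds hξ] with η hη
    exact hΦ.homogeneous r hr η hη
  have h4 := h2.unique h3
  rw [← h4]
  ext z
  simp

theorem det_eq_zero_of_apply_eq_zero {d : ℕ} {L : Euc d →L[ℝ] Euc d} {v : Euc d} (hv : v ≠ 0)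
    (hLv : L v = 0) : L.det = 0 := by
  by_contra h
  refine hv ((L.toContinuousLinearEquivOfDetNeZero h).injective ?_)
  rw [map_zero]
  exact hLv

section Dense

variable {n : ℕ}

/-- The map whose critical values contain the small vectors `a` for which the perturbation by
`⟨a, ·⟩` of the function on the sphere is not Morse. -/
def sardMap (F : Euc (n + 1) → ℝ) (ξ : Euc (n + 1)) : Euc (n + 1) :=
  ξ - ‖ξ‖⁻¹ • ξ - ‖ξ‖ • gradient F ξ

theorem differentiableAt_gradient {F : Euc (n + 1) → ℝ} (hF : IsSmoothZeroHomogeneous F)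
    {ξ : Euc (n + 1)} (hξ : ξ ≠ 0) : DifferentiableAt ℝ (gradient F) ξ :=
  (InnerProductSpace.toDual ℝ (Euc (n + 1))).symm.toContinuousLinearEquiv.differentiableAt.comp ξ
    ((hF.contDiffAt_fderiv hξ).differentiableAt (by simp))

theorem differentiableAt_sardMap {F : Euc (n + 1) → ℝ} (hF : IsSmoothZeroHomogeneous F)
    {ξ : Euc (n + 1)} (hξ : ξ ≠ 0) : DifferentiableAt ℝ (sardMap F) ξ :=
  (differentiableAt_id.sub (hasFDerivAt_normalize hξ).differentiableAt).sub
    ((hasFDerivAt_norm hξ).differentiableAt.smul (differentiableAt_gradient hF hξ))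

theorem homogeneousExtension_linearPerturbation (φ : C^∞⟮𝓡 n, Sph n; ℝ⟯) (a : Euc (n + 1))
    {ξ : Euc (n + 1)} (hξ : ξ ≠ 0) :
    homogeneousExtension (linearPerturbation φ a) ξ =
      homogeneousExtension φ ξ + innerSL ℝ a (‖ξ‖⁻¹ • ξ) := by
  rw [homogeneousExtension_eq _ hξ, homogeneousExtension_eq _ hξ, ← coe_radial hξ]
  rfl

theorem gradient_linearPerturbation (φ : C^∞⟮𝓡 n, Sph n; ℝ⟯) (a : Euc (n + 1))
    {q : Euc (n + 1)} (hq : ‖q‖ = 1) :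
    gradient (homogeneousExtension (linearPerturbation φ a)) q =
      gradient (homogeneousExtension φ) q + (a - inner ℝ a q • q) := by
  have hq0 : q ≠ 0 := fun h => by simp [h] at hq
  have hF := isSmoothZeroHomogeneous_homogeneousExtension φ
  have h1 := ((hF.contDiffAt hq0).differentiableAt (by simp)).hasFDerivAt
  have h2 := (innerSL ℝ a).hasFDerivAt.comp q (hasFDerivAt_normalize hq0)
  have h3 := (h1.add h2).congr_of_eventuallyEq
    (f₁ := homogeneousExtension (linearPerturbation φ a)) (by
      filter_upwards [isOpen_compl_singleton.mem_nhds hq0] with ξ hξ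
      exact homogeneousExtension_linearPerturbation φ a hξ)
  rw [gradient, gradient, h3.fderiv, map_add]
  congr 1
  apply (InnerProductSpace.toDual ℝ (Euc (n + 1))).injective
  rw [LinearIsometryEquiv.apply_symm_apply]
  ext z
  simp [hq]
  ring

/-- A unit vector `q` is critical for the perturbation exactly when `a` has tangential part `-∇F(q)`
at `q`, the normal part `⟨a, q⟩` being free. `sardMap` parametrizes such `a` by one vector, with
direction `q` and length `1 + ⟨a, q⟩`. -/
theorem sardMap_eq (φ : C^∞⟮𝓡 n, Sph n; ℝ⟯) (a : Euc (n + 1)) {q : Euc (n + 1)} (hq : ‖q‖ = 1)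
    (hpos : 0 < 1 + inner ℝ a q) :
    sardMap (homogeneousExtension φ) ((1 + inner ℝ a q) • q) =
      a - gradient (homogeneousExtension (linearPerturbation φ a)) q := by
  have hq0 : q ≠ 0 := fun h => by simp [h] at hq
  set r := 1 + inner ℝ a q with hr
  have hF := isSmoothZeroHomogeneous_homogeneousExtension φ
  have hn : ‖r • q‖ = r := by rw [norm_smul, hq, mul_one, Real.norm_of_nonneg hpos.le]
  have hg : r • gradient (homogeneousExtension φ) (r • q) = gradient (homogeneousExtension φ) q := by
    rw [gradient, gradient, ← hF.fderiv_smul hpos hq0, map_smul]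
  rw [sardMap, hn, hg, gradient_linearPerturbation φ a hq, smul_smul, inv_mul_cancel₀ hpos.ne',
    one_smul, hr]
  module

/-- At a degenerate critical point `p` the gradient of the perturbation vanishes, and to first order
also along some tangent `z`. By `sardMap_eq` the map takes the value `a` at `ρ p` and has zero
derivative along a curve through it. The bound `‖a‖ < 1` keeps all the lengths `1 + ⟨a, q⟩`
positive. -/
theorem mem_image_sardMap_of_not_isMorse {φ : C^∞⟮𝓡 n, Sph n; ℝ⟯} {a : Euc (n + 1)}
    (ha : ‖a‖ < 1) (hM : ¬ IsMorse (linearPerturbation φ a)) :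
    a ∈ sardMap (homogeneousExtension φ) '' {ξ | ξ ≠ 0 ∧
      (fderiv ℝ (sardMap (homogeneousExtension φ)) ξ).det = 0} := by
  rw [isMorse_iff] at hM
  push Not at hM
  obtain ⟨p, hcrit, z, hz, hDz, hz0⟩ := hM
  set F := homogeneousExtension φ with hFdef
  set G := homogeneousExtension (linearPerturbation φ a) with hGdef
  have hF : IsSmoothZeroHomogeneous F := isSmoothZeroHomogeneous_homogeneousExtension φ
  have hG : IsSmoothZeroHomogeneous G := isSmoothZeroHomogeneous_homogeneousExtension _
  have hp1 : ‖(p : Euc (n + 1))‖ = 1 := norm_coe_sphere p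
  have hp0 := coe_sphere_ne_zero p
  have hpos : ∀ q : Euc (n + 1), ‖q‖ = 1 → 0 < 1 + inner ℝ a q := fun q hq => by
    have := abs_real_inner_le_norm a q
    rw [hq, mul_one] at this
    linarith [neg_abs_le (inner ℝ a q)]
  set ρ := 1 + inner ℝ a (p : Euc (n + 1)) with hρ
  have hρ0 : 0 < ρ := hpos p hp1
  have hξ0 : ρ • (p : Euc (n + 1)) ≠ 0 := smul_ne_zero hρ0.ne' hp0
  refine ⟨ρ • (p : Euc (n + 1)), ⟨hξ0, ?_⟩, ?_⟩
  -- A curve on the sphere through `p` with velocity `z`. The curve `(1 + ⟨a, q⟩) q` has velocity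
  -- `⟨a, z⟩ p + ρ z`, nonzero since `z` is orthogonal to `p`.
  · set q : ℝ → Euc (n + 1) := fun ε =>
      ‖(p : Euc (n + 1)) + ε • z‖⁻¹ • ((p : Euc (n + 1)) + ε • z) with hq
    have hq00 : q 0 = p := by simp [hq]
    have hline : HasDerivAt (fun ε : ℝ => (p : Euc (n + 1)) + ε • z) z 0 := by
      simpa using ((hasDerivAt_id (0 : ℝ)).smul_const z).const_add (p : Euc (n + 1))
    have hqd : HasDerivAt q z 0 := by
      have h1 := hasFDerivAt_normalize hp0
      have h2 : (p : Euc (n + 1)) = (p : Euc (n + 1)) + (0 : ℝ) • z := by simp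
      rw [h2] at h1
      have h3 := h1.comp_hasDerivAt (0 : ℝ) hline
      rw [← h2] at h3
      have h4 : (‖(p : Euc (n + 1))‖⁻¹ • ContinuousLinearMap.id ℝ (Euc (n + 1)) -
          (‖(p : Euc (n + 1))‖⁻¹ ^ 3 • innerSL ℝ (p : Euc (n + 1))).smulRight
            (p : Euc (n + 1))) z = z := by
        simp [hz]
      rw [h4] at h3
      exact h3
    have hc : HasDerivAt (fun ε => (1 + inner ℝ a (q ε)) • q ε)
        (inner ℝ a z • (p : Euc (n + 1)) + ρ • z) 0 := by
      have h1 : HasDerivAt (fun ε => 1 + inner ℝ a (q ε)) (inner ℝ a z) 0 :=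
        ((innerSL ℝ a).hasFDerivAt.comp_hasDerivAt (0 : ℝ) hqd).const_add 1
      have h2 := h1.smul hqd
      rw [hq00] at h2
      rw [add_comm (inner ℝ a z • (p : Euc (n + 1)))]
      exact h2
    refine det_eq_zero_of_apply_eq_zero (v := inner ℝ a z • (p : Euc (n + 1)) + ρ • z) ?_ ?_
    · intro h
      have h1 := congrArg (fun v => inner ℝ z v) h
      simp only [inner_add_right, inner_smul_right, real_inner_comm (p : Euc (n + 1)) z, hz,
        mul_zero, zero_add, inner_zero_right] at h1
      have h2 : inner ℝ z z = 0 := by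
        rcases mul_eq_zero.1 h1 with h | h
        · exact absurd h hρ0.ne'
        · exact h
      exact hz0 (inner_self_eq_zero.1 h2)
    · have h1 : HasDerivAt (fun ε => sardMap F ((1 + inner ℝ a (q ε)) • q ε))
          (fderiv ℝ (sardMap F) (ρ • (p : Euc (n + 1)))
            (inner ℝ a z • (p : Euc (n + 1)) + ρ • z)) 0 := by
        have h2 : HasFDerivAt (sardMap F) (fderiv ℝ (sardMap F) (ρ • (p : Euc (n + 1))))
            ((1 + inner ℝ a (q 0)) • q 0) := by
          rw [hq00]
          exact (differentiableAt_sardMap hF hξ0).hasFDerivAt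
        exact h2.comp_hasDerivAt (0 : ℝ) hc
      have h3 : HasDerivAt (fun ε => a - gradient G (q ε)) 0 0 := by
        have h4 : HasFDerivAt (fderiv ℝ G) (fderiv ℝ (fderiv ℝ G) (p : Euc (n + 1))) (q 0) := by
          rw [hq00]
          exact ((hG.contDiffAt_fderiv hp0).differentiableAt (by simp)).hasFDerivAt
        have h5 := h4.comp_hasDerivAt (0 : ℝ) hqd
        rw [hDz] at h5
        have h6 := ((InnerProductSpace.toDual ℝ (Euc (n + 1))).symm.toContinuousLinearEquiv
          |>.hasFDerivAt.comp_hasDerivAt (0 : ℝ) h5).const_sub a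
        rw [map_zero, neg_zero] at h6
        exact h6
      have h7 : (fun ε => sardMap F ((1 + inner ℝ a (q ε)) • q ε)) =ᶠ[𝓝 0]
          fun ε => a - gradient G (q ε) := by
        have hne : ∀ᶠ ε in 𝓝 (0 : ℝ), (p : Euc (n + 1)) + ε • z ≠ 0 := by
          have : Tendsto (fun ε : ℝ => (p : Euc (n + 1)) + ε • z) (𝓝 0)
              (𝓝 (p : Euc (n + 1))) := by
            simpa using hline.continuousAt.tendsto
          exact this.eventually (isOpen_compl_singleton.mem_nhds hp0)
        filter_upwards [hne] with ε hε
        have hq1 : ‖q ε‖ = 1 := by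
          have : ‖(p : Euc (n + 1)) + ε • z‖ ≠ 0 := norm_ne_zero_iff.2 hε
          simp only [hq]
          rw [norm_smul, norm_inv, norm_norm, inv_mul_cancel₀ this]
        exact sardMap_eq φ a hq1 (hpos _ hq1)
      exact h1.unique (h3.congr_of_eventuallyEq h7)
  · rw [hρ, sardMap_eq φ a hp1 (hpos _ hp1), gradient, hcrit, map_zero, sub_zero]

/-- Otherwise the critical values of `sardMap` would fill a neighbourhood of `0`, although they form
a null set. -/
theorem frequently_isMorse_linearPerturbation (φ : C^∞⟮𝓡 n, Sph n; ℝ⟯) :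
    ∃ᶠ a in 𝓝 0, IsMorse (linearPerturbation φ a) := by
  intro hcon
  have hF := isSmoothZeroHomogeneous_homogeneousExtension φ
  have hnull : (volume : Measure (Euc (n + 1))) (sardMap (homogeneousExtension φ) '' {ξ | ξ ≠ 0 ∧
      (fderiv ℝ (sardMap (homogeneousExtension φ)) ξ).det = 0}) = 0 :=
    addHaar_image_eq_zero_of_det_fderivWithin_eq_zero volume
      (fun ξ hξ => (differentiableAt_sardMap hF hξ.1).hasFDerivAt.hasFDerivWithinAt)
      (fun ξ hξ => hξ.2)
  have hmem : sardMap (homogeneousExtension φ) '' {ξ | ξ ≠ 0 ∧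
      (fderiv ℝ (sardMap (homogeneousExtension φ)) ξ).det = 0} ∈ 𝓝 (0 : Euc (n + 1)) := by
    filter_upwards [hcon, Metric.ball_mem_nhds (0 : Euc (n + 1)) one_pos] with a ha hb
    exact mem_image_sardMap_of_not_isMorse (by simpa using hb) ha
  exact (Measure.measure_pos_of_mem_nhds volume hmem).ne' hnull

theorem dense_isMorse (n : ℕ) :
    @Dense _ (whitneyTopology n (Sph n)) {φ : C^∞⟮𝓡 n, Sph n; ℝ⟯ | IsMorse φ} := by
  let _ := whitneyTopology n (Sph n)
  exact fun φ => mem_closure_of_frequently_of_tendsto (frequently_isMorse_linearPerturbation φ)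
    (tendsto_linearPerturbation φ)

end Dense

/-! ### Assembling the theorem. -/

/-- A maximum point on the compact sphere supplies the nondegenerate critical point. The condition
`n ≠ 0` makes its tangent space nonzero. -/
theorem exists_regular_hessian_of_isMorse {n : ℕ} (hn : n ≠ 0) {φ : C^∞⟮𝓡 n, Sph n; ℝ⟯}
    (hφ : IsMorse φ) : ∃ ξ : Euc (n + 1), ξ ≠ 0 ∧
      ∀ w, fderiv ℝ (fderiv ℝ (homogeneousExtension φ)) ξ w = 0 → w = 0 := by
  have hF := isSmoothZeroHomogeneous_homogeneousExtension φ
  obtain ⟨p, -, hp⟩ := (isCompact_univ (X := Sph n)).exists_isMaxOn univ_nonempty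
    φ.contMDiff.continuous.continuousOn
  have hp0 := coe_sphere_ne_zero p
  have hcrit : fderiv ℝ (homogeneousExtension φ) (p : Euc (n + 1)) = 0 := by
    refine IsLocalMax.fderiv_eq_zero ?_
    filter_upwards [isOpen_compl_singleton.mem_nhds hp0] with ξ hξ
    rw [homogeneousExtension_coe, homogeneousExtension_eq φ hξ]
    exact hp (mem_univ _)
  refine exists_regular_hessian_of_nondegenerate hF (norm_coe_sphere p) hcrit
    ((isMorse_iff φ).1 hφ p hcrit) ?_
  have := Fact.mk (@finrank_euclideanSpace_fin ℝ _ (n + 1))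
  have hfin := Submodule.finrank_orthogonal_span_singleton (𝕜 := ℝ) (n := n) hp0
  have : Nontrivial (Submodule.span ℝ {(p : Euc (n + 1))})ᗮ :=
    Module.nontrivial_of_finrank_pos (R := ℝ) (by omega)
  obtain ⟨z, hz⟩ := exists_ne (0 : (Submodule.span ℝ {(p : Euc (n + 1))})ᗮ)
  exact ⟨z, Submodule.mem_orthogonal_singleton_iff_inner_right.1 z.2, fun h => hz (Subtype.ext h)⟩

end GenericMultiplier

end

theorem theorem2 :
    (∀ Φ : GenericMultiplier.Euc 2 → ℝ,
      GenericMultiplier.IsSmoothZeroHomogeneous Φ →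
      (¬ ∃ a : ℝ, ∀ ξ : GenericMultiplier.Euc 2, ξ ≠ 0 → Φ ξ = a) →
      ∀ p : ℝ, 1 < p →
        ∃ c : ℝ, 0 < c ∧ ∀ t : ℝ,
          ENNReal.ofReal (c * GenericMultiplier.japanese t ^ (2 * |1 / 2 - 1 / p|)) ≤
            GenericMultiplier.multiplierNorm Φ t p) ∧
    (∀ d n : ℕ, 3 ≤ d → d = n + 1 →
      ∃ 𝒢 : Set C^∞⟮𝓡 n, GenericMultiplier.Sph n; ℝ⟯,
        𝒢 = {φ | GenericMultiplier.IsMorse φ} ∧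
        IsOpen[GenericMultiplier.whitneyTopology n (GenericMultiplier.Sph n)] 𝒢 ∧
        @Dense _ (GenericMultiplier.whitneyTopology n (GenericMultiplier.Sph n)) 𝒢 ∧
        ∀ φ ∈ 𝒢,
          GenericMultiplier.IsSmoothZeroHomogeneous
            (GenericMultiplier.homogeneousExtension φ) ∧
          ∀ p : ℝ, 1 < p →
            ∃ c : ℝ, 0 < c ∧ ∀ t : ℝ,
              ENNReal.ofReal
                  (c * GenericMultiplier.japanese t ^ ((d : ℝ) * |1 / 2 - 1 / p|)) ≤
                GenericMultiplier.multiplierNorm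
                  (GenericMultiplier.homogeneousExtension φ) t p) := by
  refine ⟨fun Φ hΦ hnc p hp => ?_, ?_⟩
  · obtain ⟨ξ, hξ, hreg⟩ := GenericMultiplier.exists_regular_hessian_of_not_const hΦ hnc
    exact_mod_cast GenericMultiplier.exists_le_multiplierNorm hΦ hξ hreg hp
  · rintro d n hd rfl
    refine ⟨_, rfl, GenericMultiplier.isOpen_isMorse n, GenericMultiplier.dense_isMorse n,
      fun φ hφ => ?_⟩
    have hF := GenericMultiplier.isSmoothZeroHomogeneous_homogeneousExtension φ
    obtain ⟨ξ, hξ, hreg⟩ := GenericMultiplier.exists_regular_hessian_of_isMorse (by omega) hφ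
    exact ⟨hF, fun p hp => GenericMultiplier.exists_le_multiplierNorm hF hξ hreg hp⟩
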